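/- **Setting.** Fix $I\in\mathbb N$ classes and a probability space $(\Omega,\mathcal F,\mathbb P)$. For $i=1,\dots,I$ let $(IA_i(l))_{l\ge1}$ and $(ST_i(l))_{l\ge1}$ be mutually independent sequences of i.i.d. strictly positive random variables with mean $1$ and finite nonzero variance. For $n\in\mathbb N$ let $\lambda^n_i,\mu^n_i>0$ satisfy $\lambda^n_i=n\lambda_i+\sqrt n\,\hat\lambda_i+o(\sqrt n)$ and $\mu^n_i=n\mu_i+\sqrt n\,\hat\mu_i+o(\sqrt n)$, where $\lambda_i,\mu_i>0$, $\hat\lambda_i,\hat\mu_i\in\mathbb R$, and $\sum_i\rho_i=1$ with $\rho_i=\lambda_i/\mu_i$. Put $$A^n_i(t)=\sup\Big\{l\ge0:\sum_{k=1}^l IA_i(k)\le\lambda^n_it\Big\},\qquad S^n_i(t)=\sup\Big\{l\ge0:\sum_{k=1}^l ST_i(k)\le\mu^n_it\Big\}.$$ Let $X^n_i(0)\in\{0,1,2,\dots\}$ be deterministic. An *admissible control* for the $n$-th system is a pair $U^n=(Z^n,B^n)$ of processes on $[0,\infty)$ with right-continuous paths with left limits (RCLL) such that: * $B^n$ takes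 values in $\{\beta\in\mathbb R_+^I:\sum_i\beta_i\le1\}$, and $Z^n$ in $\mathbb R_+^I$ with nondecreasing components; * $Z^n_i(t)=\int_{[0,t]}z^{n,i}_s\,dA^n_i(s)$ for some $\{0,1\}$-valued process $z^{n,i}$ (so $Z^n_i$ counts rejected class-$i$ arrivals); * with $T^n_i(t)=\int_0^tB^n_i(s)\,ds$, $D^n_i(t)=S^n_i(T^n_i(t))$ and $X^n_i(t)=X^n_i(0)+A^n_i(t)-D^n_i(t)-Z^n_i(t)$, the process $(Z^n,B^n)$ is adapted to $\mathcal F^n_t=\sigma\{A^n_i(s),D^n_i(s):1\le i\le I,\ s\le t\}$, and almost surely, for all $i$ and $t\ge0$, $X^n_i(t)=0$ implies $B^n_i(t)=0$. Put $\hat X^n=X^n/\sqrt n$ and $\hat Y^n_i(t)=\frac{\mu^n_i}{\sqrt n}(\rho_it-T^n_i(t))$. The time of the first class-$i$ admission after $t$, the departure time of that customer, and its scaled throughput time are $$AT^n_i(t)=\inf\{s>t:(A^n_i-Z^n_i)(s)>(A^n_i-Z^n_i)(t)\},$$ $$DT^n_i(t)=\inf\{s\ge0:D^n_i(s)\ge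 D^n_i(AT^n_i(t))+X^n_i(AT^n_i(t))\},\qquad \hat\Theta^n_i(t)=\sqrt n\,\big(DT^n_i(t)-AT^n_i(t)\big),$$ with $\inf\emptyset=\infty$. Write $\|y\|_T=\sup_{t\in[0,T]}\sum_i|y_i(t)|$. A sequence of processes is $C$-tight on $[0,T]$ if its laws on $D_{\mathbb R^I}[0,T]$, the space of RCLL maps from $[0,T]$ to $\mathbb R^I$ with the Skorohod topology, are tight and every subsequential limit in distribution has continuous paths almost surely. **Proposition (conditional pathwise Little's law).** Let $0<T<T'$, and let $U^n$, $n\in\mathbb N$, be any sequence of admissible controls such that $\hat Y^n$ are $C$-tight on $[0,T']$ and the random variables $\|\hat X^n\|_T$ are tight. Set $$E^n_i(t)=\hat X^n_i(AT^n_i(t))-\lambda_i\hat\Theta^n_i(t),\qquad \tilde E^n_i(t)=\hat X^n_i(t)-\lambda_i\hat\Theta^n_i(t),$$ and set $|E^n_i(t)|=|\tilde E^n_i(t)|=\infty$ if $AT^n_i(t)$ or $DT^n_i(t)$ is infinite. Then $\|E^n\|_T\to0$ in distribution (equivalently, in probability). If, in addition, $\hat X^n$ are $C$-tight on $[0,T']$,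 then also $\|\tilde E^n\|_T\to0$ in distribution. In particular this applies, for every $T>0$, if $C$-tightness is understood for processes on $[0,\infty)$, that is, on every compact interval $[0,T']$. -/

import Mathlib

open MeasureTheory ProbabilityTheory Filter Topology
open scoped ENNReal NNReal

noncomputable section

namespace HeavyTraffic

/-! ### Right-continuous paths with left limits, the Skorohod topology, `C`-tightness -/

/-- `f` is right-continuous with left limits (at a minimal point of `α` the filter `𝓝[<] t` is
trivial, so the condition on the left limit is void there). -/
def IsRCLL {α E : Type*} [TopologicalSpace α] [Preorder α] [TopologicalSpace E]
    (f : α → E) : Prop :=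
  ∀ t, ContinuousWithinAt f (Set.Ici t) t ∧ ∃ l, Tendsto f (𝓝[<] t) (𝓝 l)

/-- The space `D_E[0,T]` of RCLL maps from `[0,T]` to `E`. -/
structure SkorohodSpace (T : ℝ) (E : Type*) [TopologicalSpace E] where
  toFun : Set.Icc (0 : ℝ) T → E
  rcll : IsRCLL toFun

namespace SkorohodSpace

variable {T : ℝ} {E : Type*} [PseudoEMetricSpace E]

/-- The cost of matching `x` with `y` through the time change `φ`, an increasing bijection of
`[0,T]` onto itself: the larger of `sup_t |t - φ t|` and `sup_t d(x t, y (φ t))`. -/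
def cost (x y : SkorohodSpace T E) (φ : Set.Icc (0 : ℝ) T ≃o Set.Icc (0 : ℝ) T) : ℝ≥0∞ :=
  max (⨆ t, edist t (φ t)) (⨆ t, edist (x.toFun t) (y.toFun (φ t)))

lemma cost_symm_le (x y : SkorohodSpace T E) (φ : Set.Icc (0 : ℝ) T ≃o Set.Icc (0 : ℝ) T) :
    cost y x φ.symm ≤ cost x y φ := by
  refine max_le_max (iSup_le fun t => ?_) (iSup_le fun t => ?_)
  · refine le_iSup_of_le (φ.symm t) ?_
    rw [OrderIso.apply_symm_apply, edist_comm]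
  · refine le_iSup_of_le (φ.symm t) ?_
    rw [OrderIso.apply_symm_apply, edist_comm]

lemma cost_trans_le (x y z : SkorohodSpace T E)
    (φ ψ : Set.Icc (0 : ℝ) T ≃o Set.Icc (0 : ℝ) T) :
    cost x z (φ.trans ψ) ≤ cost x y φ + cost y z ψ := by
  refine max_le (iSup_le fun t => ?_) (iSup_le fun t => ?_)
  · refine (edist_triangle _ (φ t) _).trans (add_le_add ?_ ?_)
    · exact (le_iSup (fun t => edist t (φ t)) t).trans (le_max_left _ _)
    · exact (le_iSup (fun t => edist t (ψ t)) (φ t)).trans (le_max_left _ _)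
  · refine (edist_triangle _ (y.toFun (φ t)) _).trans (add_le_add ?_ ?_)
    · exact (le_iSup (fun t => edist (x.toFun t) (y.toFun (φ t))) t).trans (le_max_right _ _)
    · exact (le_iSup (fun t => edist (y.toFun t) (z.toFun (ψ t))) (φ t)).trans
        (le_max_right _ _)

/-- The Skorohod `J₁` distance; it induces the usual Skorohod topology on `D_E[0,T]`. -/
instance : PseudoEMetricSpace (SkorohodSpace T E) where
  edist x y := ⨅ φ, cost x y φ
  edist_self x := by
    refine le_antisymm (iInf_le_of_le (OrderIso.refl _) ?_) bot_le
    simp [cost]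
  edist_comm x y := by
    refine le_antisymm (le_iInf fun φ => ?_) (le_iInf fun φ => ?_)
    · exact iInf_le_of_le φ.symm (cost_symm_le y x φ)
    · exact iInf_le_of_le φ.symm (cost_symm_le x y φ)
  edist_triangle x y z :=
    ENNReal.le_iInf_add_iInf fun φ ψ => iInf_le_of_le (φ.trans ψ) (cost_trans_le x y z φ ψ)

instance : MeasurableSpace (SkorohodSpace T E) := borel _

instance : BorelSpace (SkorohodSpace T E) := ⟨rfl⟩

end SkorohodSpace

/-- The processes `Y n` with time set `[0,∞)`, restricted to `[0,T]`, are `C`-tight: they are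
(up to null sets) random elements of `D_E[0,T]`, their laws are tight, and every limit in
distribution of a subsequence has continuous sample paths with probability one. -/
def CTight {Ω E : Type*} [MeasurableSpace Ω] (P : Measure Ω) [IsProbabilityMeasure P]
    [PseudoEMetricSpace E] (T : ℝ) (Y : ℕ → ℝ → Ω → E) : Prop :=
  ∃ (y : ℕ → Ω → SkorohodSpace T E) (hy : ∀ n, AEMeasurable (y n) P),
    (∀ n, ∀ᵐ ω ∂P, ∀ t : Set.Icc (0 : ℝ) T, (y n ω).toFun t = Y n t ω) ∧
    IsTightMeasureSet (Set.range fun n => P.map (y n)) ∧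
    ∀ φ : ℕ → ℕ, StrictMono φ → ∀ ν : ProbabilityMeasure (SkorohodSpace T E),
      Tendsto (β := ProbabilityMeasure (SkorohodSpace T E))
        (fun k => ⟨P.map (y (φ k)), Measure.isProbabilityMeasure_map (hy (φ k))⟩) atTop (𝓝 ν) →
      ∀ᵐ x ∂(ν : Measure (SkorohodSpace T E)), Continuous x.toFun

/-- A sequence of `[0,∞]`-valued random variables is tight (as random variables with values in
`[0,∞)`). -/
def TightVars {Ω : Type*} [MeasurableSpace Ω] (P : Measure Ω) (R : ℕ → Ω → ℝ≥0∞) : Prop :=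
  ∀ ε : ℝ≥0∞, 0 < ε → ∃ K : ℝ≥0, ∀ n, P {ω | (K : ℝ≥0∞) < R n ω} ≤ ε

/-- A sequence of `[0,∞]`-valued random variables converges to zero in distribution,
equivalently in probability. -/
def ConvergesToZero {Ω : Type*} [MeasurableSpace Ω] (P : Measure Ω) (R : ℕ → Ω → ℝ≥0∞) : Prop :=
  ∀ ε : ℝ≥0∞, 0 < ε → Tendsto (fun n => P {ω | ε < R n ω}) atTop (𝓝 0)

/-! ### The multiclass G/G/1 model -/

/-- `sup {l ≥ 0 : ξ₁ + ⋯ + ξ_l ≤ t}`; the sequence is indexed from `0`, so `ξ₁` is `ξ 0`. -/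
def renewalCount (ξ : ℕ → ℝ) (t : ℝ) : ℕ :=
  sSup {l : ℕ | ∑ k ∈ Finset.range l, ξ k ≤ t}

/-- Data of the sequence of systems: `I` classes, interarrival and service time sequences, and
heavy traffic parameters. -/
structure Model (I : ℕ) {Ω : Type*} [MeasurableSpace Ω] (P : Measure Ω) where
  /-- normalized interarrival times `IA_i(l)` -/
  IA : Fin I → ℕ → Ω → ℝ
  /-- normalized service times `ST_i(l)` -/
  ST : Fin I → ℕ → Ω → ℝ
  IA_measurable : ∀ i l, Measurable (IA i l)
  ST_measurable : ∀ i l, Measurable (ST i l)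
  IA_pos : ∀ i l ω, 0 < IA i l ω
  ST_pos : ∀ i l ω, 0 < ST i l ω
  IA_identDistrib : ∀ i l, IdentDistrib (IA i l) (IA i 0) P P
  ST_identDistrib : ∀ i l, IdentDistrib (ST i l) (ST i 0) P P
  /-- all the interarrival and service times are mutually independent -/
  indep : iIndepFun (Sum.elim (fun p : Fin I × ℕ => IA p.1 p.2)
    (fun p : Fin I × ℕ => ST p.1 p.2)) P
  IA_mean : ∀ i, ∫ ω, IA i 0 ω ∂P = 1
  ST_mean : ∀ i, ∫ ω, ST i 0 ω ∂P = 1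
  /-- finite second moments and nonzero variances, that is, squared coefficients of variation in
  `(0,∞)` -/
  IA_memLp : ∀ i, MemLp (IA i 0) 2 P
  ST_memLp : ∀ i, MemLp (ST i 0) 2 P
  IA_variance_pos : ∀ i, 0 < variance (IA i 0) P
  ST_variance_pos : ∀ i, 0 < variance (ST i 0) P
  /-- arrival rates `λ^n_i` -/
  lamN : ℕ → Fin I → ℝ
  /-- service rates `μ^n_i` -/
  muN : ℕ → Fin I → ℝ
  lam : Fin I → ℝ
  mu : Fin I → ℝ
  lamHat : Fin I → ℝ
  muHat : Fin I → ℝ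
  lamN_pos : ∀ n i, 0 < lamN n i
  muN_pos : ∀ n i, 0 < muN n i
  lam_pos : ∀ i, 0 < lam i
  mu_pos : ∀ i, 0 < mu i
  lamN_expansion : ∀ i, (fun n : ℕ => lamN n i - (n * lam i + √n * lamHat i))
    =o[atTop] fun n : ℕ => √(n : ℝ)
  muN_expansion : ∀ i, (fun n : ℕ => muN n i - (n * mu i + √n * muHat i))
    =o[atTop] fun n : ℕ => √(n : ℝ)
  /-- critical load -/
  critical : ∑ i, lam i / mu i = 1
  /-- deterministic initial numbers of customers `X^n_i(0)` -/
  X0 : ℕ → Fin I → ℕ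

/-- A control `U^n = (Z^n, B^n)`: cumulative rejections and effort allocation. -/
structure Control (I : ℕ) (Ω : Type*) where
  Z : ℝ → Ω → Fin I → ℝ
  B : ℝ → Ω → Fin I → ℝ

namespace Model

variable {I : ℕ} {Ω : Type*} [MeasurableSpace Ω] {P : Measure Ω} (M : Model I P)

/-- `A^n_i(t)`, the number of class-`i` arrivals up to time `t`. -/
def A (n : ℕ) (i : Fin I) (t : ℝ) (ω : Ω) : ℕ :=
  renewalCount (fun l => M.IA i l ω) (M.lamN n i * t)

/-- The time of the class-`i` arrival number `l + 1` in the `n`-th system. -/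
def arrivalTime (n : ℕ) (i : Fin I) (l : ℕ) (ω : Ω) : ℝ :=
  (∑ k ∈ Finset.range (l + 1), M.IA i k ω) / M.lamN n i

/-- `S^n_i(t)`, the potential service process. -/
def S (n : ℕ) (i : Fin I) (t : ℝ) (ω : Ω) : ℕ :=
  renewalCount (fun l => M.ST i l ω) (M.muN n i * t)

end Model

/-- `T^n_i(t) = ∫₀ᵗ B^n_i(s) ds`. -/
def Control.busy {I : ℕ} {Ω : Type*} (U : Control I Ω) (i : Fin I) (t : ℝ) (ω : Ω) : ℝ :=
  ∫ s in (0 : ℝ)..t, U.B s ω i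

namespace Model

variable {I : ℕ} {Ω : Type*} [MeasurableSpace Ω] {P : Measure Ω} (M : Model I P)
  (n : ℕ) (U : Control I Ω)

/-- `D^n_i(t) = S^n_i(T^n_i(t))`, the number of class-`i` departures up to time `t`. -/
def D (i : Fin I) (t : ℝ) (ω : Ω) : ℕ :=
  M.S n i (U.busy i t ω) ω

/-- The queuelength process `X^n_i = X^n_i(0) + A^n_i - D^n_i - Z^n_i`. -/
def X (i : Fin I) (t : ℝ) (ω : Ω) : ℝ :=
  M.X0 n i + M.A n i t ω - M.D n U i t ω - U.Z t ω i

/-- The diffusion-scaled queuelength `X^n / √n`. -/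
def XHat (t : ℝ) (ω : Ω) : Fin I → ℝ :=
  fun i => M.X n U i t ω / √n

/-- `Ŷ^n_i(t) = (μ^n_i / √n) (ρ_i t - T^n_i(t))`, with `ρ_i = λ_i / μ_i`. -/
def YHat (t : ℝ) (ω : Ω) : Fin I → ℝ :=
  fun i => M.muN n i / √n * (M.lam i / M.mu i * t - U.busy i t ω)

/-- The `σ`-algebra generated by `A^n_i(s)` and `D^n_i(s)`, for all `i` and all `s ∈ [0,t]`. -/
@[reducible]
def history (t : ℝ) : MeasurableSpace Ω :=
  ⨆ i : Fin I, ⨆ s ∈ Set.Icc (0 : ℝ) t,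
    MeasurableSpace.comap (M.A n i s) ⊤ ⊔ MeasurableSpace.comap (M.D n U i s) ⊤

/-- `U` is an admissible control for the `n`-th system (no buffer constraints). -/
structure Admissible : Prop where
  Z_nonneg : ∀ ω i t, 0 ≤ t → 0 ≤ U.Z t ω i
  Z_mono : ∀ ω i, MonotoneOn (fun t => U.Z t ω i) (Set.Ici 0)
  Z_rcll : ∀ ω, IsRCLL fun t : Set.Ici (0 : ℝ) => U.Z t ω
  /-- `B` takes values in the set of allocation vectors -/
  B_nonneg : ∀ ω i t, 0 ≤ t → 0 ≤ U.B t ω i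
  B_sum_le : ∀ ω t, 0 ≤ t → ∑ i, U.B t ω i ≤ 1
  B_rcll : ∀ ω, IsRCLL fun t : Set.Ici (0 : ℝ) => U.B t ω
  /-- `Z_i(t) = ∫_{[0,t]} z^i_s dA_i(s)`, where `z^i_s` is `1` if a class-`i` customer that arrives
  at time `s` is rejected and `0` otherwise. The path of `A_i` has a unit jump at each arrival
  time, so the integral is a sum over the arrivals up to time `t`. -/
  rejection : ∃ z : Fin I → ℝ → Ω → ℝ, (∀ i s ω, z i s ω = 0 ∨ z i s ω = 1) ∧
    ∀ᵐ ω ∂P, ∀ i t, 0 ≤ t →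
      U.Z t ω i = ∑ l ∈ Finset.range (M.A n i t ω), z i (M.arrivalTime n i l ω) ω
  Z_adapted : ∀ t, 0 ≤ t → Measurable[M.history n U t] (U.Z t)
  B_adapted : ∀ t, 0 ≤ t → Measurable[M.history n U t] (U.B t)
  /-- no effort is given to an empty class -/
  idle_when_empty : ∀ᵐ ω ∂P, ∀ i t, 0 ≤ t → M.X n U i t ω = 0 → U.B t ω i = 0

/-! ### Throughput times -/

/-- The admission counting process `AD^n_i = A^n_i - Z^n_i`. -/
def AD (i : Fin I) (t : ℝ) (ω : Ω) : ℝ :=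
  M.A n i t ω - U.Z t ω i

/-- The times after `t` by which a further class-`i` customer has been admitted. -/
def admissionSet (i : Fin I) (t : ℝ) (ω : Ω) : Set ℝ :=
  {s | t < s ∧ M.AD n U i t ω < M.AD n U i s ω}

/-- `AT^n_i(t)`, the time of the first class-`i` admission after `t`
(meaningful if `admissionSet` is nonempty; otherwise that time is infinite). -/
def AT (i : Fin I) (t : ℝ) (ω : Ω) : ℝ :=
  sInf (M.admissionSet n U i t ω)

/-- The times by which the customer admitted at `AT^n_i(t)` has left. -/
def departureSet (i : Fin I) (t : ℝ) (ω : Ω) : Set ℝ :=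
  {s | 0 ≤ s ∧
    (M.D n U i (M.AT n U i t ω) ω : ℝ) + M.X n U i (M.AT n U i t ω) ω ≤ M.D n U i s ω}

/-- `DT^n_i(t)`, the departure time of the customer admitted at `AT^n_i(t)`
(meaningful if `departureSet` is nonempty; otherwise that time is infinite). -/
def DT (i : Fin I) (t : ℝ) (ω : Ω) : ℝ :=
  sInf (M.departureSet n U i t ω)

/-- Both `AT^n_i(t)` and `DT^n_i(t)` are finite. -/
def FiniteTimes (i : Fin I) (t : ℝ) (ω : Ω) : Prop :=
  (M.admissionSet n U i t ω).Nonempty ∧ (M.departureSet n U i t ω).Nonempty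

/-- The diffusion-scaled throughput time `√n (DT^n_i(t) - AT^n_i(t))`. -/
def thetaHat (i : Fin I) (t : ℝ) (ω : Ω) : ℝ :=
  √n * (M.DT n U i t ω - M.AT n U i t ω)

/-- `|X̂^n_i(AT^n_i(t)) - λ_i Θ̂^n_i(t)|`, infinite if one of the two times is infinite. -/
def absE (i : Fin I) (t : ℝ) (ω : Ω) : ℝ≥0∞ :=
  open Classical in
  if M.FiniteTimes n U i t ω then
    ENNReal.ofReal |M.XHat n U (M.AT n U i t ω) ω i - M.lam i * M.thetaHat n U i t ω|
  else ⊤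

/-- `|X̂^n_i(t) - λ_i Θ̂^n_i(t)|`, infinite if one of the two times is infinite. -/
def absETilde (i : Fin I) (t : ℝ) (ω : Ω) : ℝ≥0∞ :=
  open Classical in
  if M.FiniteTimes n U i t ω then
    ENNReal.ofReal |M.XHat n U t ω i - M.lam i * M.thetaHat n U i t ω|
  else ⊤

/-- `‖X̂^n‖_T = sup_{t ∈ [0,T]} ∑_i |X̂^n_i(t)|`. -/
def supXHat (T : ℝ) (ω : Ω) : ℝ≥0∞ :=
  ⨆ t ∈ Set.Icc (0 : ℝ) T, ∑ i, ENNReal.ofReal |M.XHat n U t ω i|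

/-- `‖E^n‖_T`. -/
def supE (T : ℝ) (ω : Ω) : ℝ≥0∞ :=
  ⨆ t ∈ Set.Icc (0 : ℝ) T, ∑ i, M.absE n U i t ω

/-- `‖Ẽ^n‖_T`. -/
def supETilde (T : ℝ) (ω : Ω) : ℝ≥0∞ :=
  ⨆ t ∈ Set.Icc (0 : ℝ) T, ∑ i, M.absETilde n U i t ω

end Model

end HeavyTraffic

end

noncomputable section

namespace HeavyTraffic

/-! ### Weak limits of tight sequences -/

/-! The proof works path by path on an event of probability close to one. Fix a class and let `w` be
the work scaled by the service rate, so that `l` departures have occurred exactly when `w` has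
reached the partial sum `σ l` of service times. If a customer is admitted at time `a` and leaves at
`d`, then `w d` equals `σ` at the total input up to `a`, while `w a` lies within one service time of
`σ (D a)`. Hence `w d - w a` is a sum of about `X a` service times. Two estimates finish the
argument. Consecutive service times, at most of order `√n` many among the first `O(n)`, add up to
their number with error `o(√n)`. On the other hand `w d - w a` is `lam * n * (d - a)` with error
`o(√n)`, because `w` is a linear drift minus `√n` times `YHat`, and `YHat` has a small modulus of
continuity. Division by `√n` gives the law. Both estimates require `d - a` and the wait for an
admission to be `O(1/√n)`: in time `c / √n` about `lam * c * √n` units of work are done, more than a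
queue of size `K√n` can absorb. This is `QueuePath.abs_queue_sub_le`. The modulus is
`CTight.modulus`, obtained by contradiction from Prokhorov's theorem and the portmanteau inequality
for closed sets. The service estimate is `tendsto_measure_increment_gt`: about `√n` blocks of length
of order `√n` cover the range, so a union bound works once a single block fails with probability
`o(1/√n)`. With two moments only, this rate comes from truncation and a fourth moment bound
(`exists_forall_mul_measureReal_sum_le`). For the second error, the admission occurs within `c / √n`
of `t`, so the modulus of `XHat` allows replacing the queue at the admission time by the queue at
`t`. -/

/-- Every tight sequence of probability measures on a metrizable space has a weakly convergent
subsequence. -/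
theorem exists_subseq_tendsto_of_isTightMeasureSet {E : Type*} [TopologicalSpace E]
    [TopologicalSpace.PseudoMetrizableSpace E] [T2Space E] [MeasurableSpace E] [BorelSpace E]
    (μ : ℕ → ProbabilityMeasure E)
    (h : IsTightMeasureSet (Set.range fun n => (μ n : Measure E))) :
    ∃ (φ : ℕ → ℕ) (ν : ProbabilityMeasure E), StrictMono φ ∧
      Tendsto (fun k => μ (φ k)) atTop (𝓝 ν) := by
  rw [isTightMeasureSet_iff_exists_isCompact_measure_compl_le] at h
  have h' : ∀ m : ℕ, ∃ K : Set E, IsCompact K ∧ ∀ n, (μ n : Measure E) Kᶜ ≤ ((m : ℝ≥0∞) + 1)⁻¹ := by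
    intro m
    obtain ⟨K, hK, hKμ⟩ := h ((m : ℝ≥0∞) + 1)⁻¹ (by simp)
    exact ⟨K, hK, fun n => hKμ _ ⟨n, rfl⟩⟩
  choose K hK hKμ using h'
  -- All the laws are carried by this σ-compact set. It is separable, so weak convergence on it is
  -- metrizable and the compactness given by Prokhorov's theorem yields subsequences, although the
  -- whole space is not assumed separable.
  set F : Set E := ⋃ m, K m with hF
  have hFm : MeasurableSet F := MeasurableSet.iUnion fun m => (hK m).measurableSet
  have hF0 : ∀ n, (μ n : Measure E) Fᶜ = 0 := by
    intro n
    have hle : ∀ m : ℕ, (μ n : Measure E) Fᶜ ≤ ((m : ℝ≥0∞) + 1)⁻¹ := fun m =>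
      (measure_mono (Set.compl_subset_compl.2 (Set.subset_iUnion K m))).trans (hKμ m n)
    have hlim : Tendsto (fun m : ℕ => ((m : ℝ≥0∞) + 1)⁻¹) atTop (𝓝 0) := by
      have := (tendsto_add_atTop_iff_nat 1).2 ENNReal.tendsto_inv_nat_nhds_zero
      simpa using this
    exact le_antisymm (ge_of_tendsto' hlim hle) bot_le
  have hsep : TopologicalSpace.IsSeparable F := by
    let _ := TopologicalSpace.pseudoMetrizableSpacePseudoMetric E
    exact TopologicalSpace.IsSeparable.iUnion fun m => (hK m).isSeparable
  have : TopologicalSpace.SeparableSpace F := by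
    let _ := TopologicalSpace.pseudoMetrizableSpacePseudoMetric E
    exact hsep.separableSpace
  have hemb : MeasurableEmbedding (Subtype.val : F → E) := MeasurableEmbedding.subtype_coe hFm
  have hmap : ∀ n, ((μ n : Measure E).comap (Subtype.val : F → E)).map Subtype.val = μ n := by
    intro n
    rw [hemb.map_comap, Subtype.range_val]
    exact Measure.restrict_eq_self_of_ae_mem (by rw [ae_iff]; exact hF0 n)
  have hprob : ∀ n, IsProbabilityMeasure ((μ n : Measure E).comap (Subtype.val : F → E)) := by
    intro n
    constructor
    have := congrArg (fun m : Measure E => m Set.univ) (hmap n)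
    simp only [Measure.map_apply hemb.measurable MeasurableSet.univ, Set.preimage_univ,
      measure_univ] at this
    exact this
  set κ : ℕ → ProbabilityMeasure F := fun n => ⟨_, hprob n⟩ with hκ
  have hκt : IsTightMeasureSet {((ρ : ProbabilityMeasure F) : Measure F) | ρ ∈ Set.range κ} := by
    rw [isTightMeasureSet_iff_exists_isCompact_measure_compl_le]
    intro ε hε
    obtain ⟨m, hm⟩ := ENNReal.exists_inv_nat_lt hε.ne'
    refine ⟨Subtype.val ⁻¹' K m, ?_, ?_⟩
    · refine Topology.IsInducing.subtypeVal.isCompact_preimage_iff ?_ |>.2 (hK m)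
      rw [Subtype.range_val]
      exact Set.subset_iUnion K m
    · rintro _ ⟨_, ⟨n, rfl⟩, rfl⟩
      have h1 : ((κ n : ProbabilityMeasure F) : Measure F) (Subtype.val ⁻¹' K m)ᶜ
          = (μ n : Measure E) (K m)ᶜ := by
        rw [← Set.preimage_compl, ← Measure.map_apply hemb.measurable (hK m).measurableSet.compl]
        exact congrArg (fun q : Measure E => q (K m)ᶜ) (hmap n)
      rw [h1]
      refine (hKμ m n).trans (le_trans ?_ hm.le)
      exact ENNReal.inv_le_inv.2 (by simp)
  obtain ⟨ν, -, φ, hφ, hlim⟩ := (isCompact_closure_of_isTightMeasureSet hκt).isSeqCompact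
    (x := κ) (fun n => subset_closure ⟨n, rfl⟩)
  refine ⟨φ, ν.map (hemb.measurable.aemeasurable), hφ, ?_⟩
  have := (ProbabilityMeasure.continuous_map (f := (Subtype.val : F → E))
    continuous_subtype_val).continuousAt.tendsto.comp hlim
  convert this using 1
  funext k
  apply Subtype.ext
  exact (hmap (φ k)).symm

/-! ### Separation and moduli of continuity in the Skorohod space -/

namespace SkorohodSpace

variable {T : ℝ} {E : Type*}

lemma exists_timeChange_of_edist_lt [PseudoEMetricSpace E] {x y : SkorohodSpace T E} {r : ℝ≥0∞}
    (h : edist x y < r) : ∃ φ : Set.Icc (0 : ℝ) T ≃o Set.Icc (0 : ℝ) T,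
      ∀ t, edist t (φ t) < r ∧ edist (x.toFun t) (y.toFun (φ t)) < r := by
  obtain ⟨φ, hφ⟩ := iInf_lt_iff.1 h
  refine ⟨φ, fun t => ⟨lt_of_le_of_lt ?_ hφ, lt_of_le_of_lt ?_ hφ⟩⟩
  · exact (le_iSup (fun t => edist t (φ t)) t).trans (le_max_left _ _)
  · exact (le_iSup (fun t => edist (x.toFun t) (y.toFun (φ t))) t).trans (le_max_right _ _)

/-- Right-continuity settles `t < T`: compare the paths at a point slightly to the right of `t`,
with a time change that moves points by less than the gap to `t`, so that the image also stays to
the right of `t`. At `t = T` every time change fixes the endpoint. -/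
lemma edist_toFun_le_of_edist_eq_zero [PseudoEMetricSpace E] {x y : SkorohodSpace T E}
    (h : edist x y = 0) (t : Set.Icc (0 : ℝ) T) {η : ℝ≥0∞} (hη : 0 < η) :
    edist (x.toFun t) (y.toFun t) ≤ η + η + η := by
  rcases eq_or_lt_of_le t.2.2 with htT | htT
  · obtain ⟨φ, hφ⟩ := exists_timeChange_of_edist_lt (h.trans_lt hη)
    have hφt : φ t = t := by
      have htop : ∀ u, u ≤ t := fun u => Subtype.coe_le_coe.1 (u.2.2.trans htT.ge)
      refine le_antisymm (htop _) ?_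
      have := htop (φ.symm t)
      simpa using φ.monotone this
    have := (hφ t).2
    rw [hφt] at this
    exact this.le.trans (by rw [add_assoc]; exact le_self_add)
  · have hx := (x.rcll t).1
    have hy := (y.rcll t).1
    have hx' := hx.eventually (Metric.eball_mem_nhds (x.toFun t) hη)
    have hy' := hy.eventually (Metric.eball_mem_nhds (y.toFun t) hη)
    have hxy := hx'.and hy'
    rw [eventually_nhdsWithin_iff, Metric.eventually_nhds_iff] at hxy
    obtain ⟨δ, hδ, hball⟩ := hxy
    set s : ℝ := min (t + δ / 2) T with hs
    have hts : (t : ℝ) < s := lt_min (by linarith) htT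
    have hsδ : s ≤ t + δ / 2 := min_le_left _ _
    set s' : Set.Icc (0 : ℝ) T := ⟨s, t.2.1.trans hts.le, min_le_right _ _⟩
    set r := min η (ENNReal.ofReal (s - t)) with hr
    have hr0 : 0 < r := lt_min hη (by simpa using hts)
    obtain ⟨φ, hφ⟩ := exists_timeChange_of_edist_lt (h.trans_lt hr0)
    obtain ⟨h1, h2⟩ := hφ s'
    have h3 : |s - (φ s' : ℝ)| < s - t := by
      have : edist s' (φ s') < ENNReal.ofReal (s - t) := h1.trans_le (min_le_right _ _)
      rw [edist_dist, ENNReal.ofReal_lt_ofReal_iff (by linarith)] at this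
      exact this
    rw [abs_lt] at h3
    have ht1 : t ≤ s' := Subtype.coe_le_coe.1 hts.le
    have ht2 : t ≤ φ s' := Subtype.coe_le_coe.1 (by linarith)
    have h4 := hball (y := s') (by
      rw [Subtype.dist_eq, Real.dist_eq, abs_lt]
      constructor <;> simp [s'] <;> linarith) ht1
    have h5 := hball (y := φ s') (by
      rw [Subtype.dist_eq, Real.dist_eq, abs_lt]
      constructor <;> linarith) ht2
    have h6 : edist (x.toFun t) (x.toFun s') ≤ η := by
      rw [edist_comm]; exact le_of_lt (by simpa using h4.1)
    have h7 : edist (y.toFun (φ s')) (y.toFun t) ≤ η := le_of_lt (by simpa using h5.2)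
    have h8 : edist (x.toFun s') (y.toFun (φ s')) ≤ η := h2.le.trans (min_le_left _ _)
    exact (edist_triangle4 _ _ _ _).trans (add_le_add (add_le_add h6 h8) h7)

/-- Separation makes compact sets closed, hence Borel, as the extraction of weak limits requires. -/
instance [EMetricSpace E] : T2Space (SkorohodSpace T E) := by
  have : T0Space (SkorohodSpace T E) := by
    rw [t0Space_iff_inseparable]
    intro x y h
    rw [EMetric.inseparable_iff] at h
    have hxy : x.toFun = y.toFun := by
      funext t
      refine edist_eq_zero.1 (le_antisymm ?_ bot_le)
      refine le_of_forall_gt fun c hc => ?_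
      obtain ⟨d, hd0, hdc⟩ := exists_between hc
      have hd3 : 0 < d / 3 := ENNReal.div_pos hd0.ne' (by norm_num)
      refine lt_of_le_of_lt (edist_toFun_le_of_edist_eq_zero h t hd3) ?_
      rwa [ENNReal.add_thirds]
    cases x; cases y; congr
  infer_instance

/-- The paths that oscillate by more than `ε` on some time window of length at most `δ`. -/
def oscillating [PseudoEMetricSpace E] (T : ℝ) (ε : ℝ≥0∞) (δ : ℝ) : Set (SkorohodSpace T E) :=
  {x | ∃ s t, dist s t ≤ δ ∧ ε < edist (x.toFun s) (x.toFun t)}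

lemma oscillating_mono [PseudoEMetricSpace E] (ε : ℝ≥0∞) {δ δ' : ℝ} (h : δ ≤ δ') :
    oscillating (E := E) T ε δ ⊆ oscillating T ε δ' := by
  rintro x ⟨s, t, hst, hx⟩
  exact ⟨s, t, hst.trans h, hx⟩

/-- A time change close to the identity moves each end of the window by at most `(δ' - δ) / 2` and
each value by at most `r`. Passing to closures, as the portmanteau inequality demands, therefore
costs only an arbitrarily small loss in both parameters. -/
lemma mem_oscillating_of_mem_closure [PseudoEMetricSpace E] {ε ε' : ℝ≥0∞} {δ δ' : ℝ} (hε : ε' < ε)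
    (hδ : δ < δ') {x : SkorohodSpace T E} (hx : x ∈ closure (oscillating T ε δ)) :
    x ∈ oscillating T ε' δ' := by
  obtain ⟨r, hr0, hr⟩ : ∃ r : ℝ≥0∞, 0 < r ∧ ε' + (r + r) < ε := by
    obtain ⟨d, hd0, hd⟩ := ENNReal.lt_iff_exists_add_pos_lt.1 hε
    refine ⟨d / 2, ENNReal.half_pos (by simpa using hd0.ne'), ?_⟩
    rwa [ENNReal.add_halves]
  have hr' : 0 < min r (ENNReal.ofReal ((δ' - δ) / 2)) :=
    lt_min hr0 (by simpa using hδ)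
  obtain ⟨y, ⟨s, t, hst, hy⟩, hxy⟩ := EMetric.mem_closure_iff.1 hx _ hr'
  rw [edist_comm] at hxy
  obtain ⟨φ, hφ⟩ := exists_timeChange_of_edist_lt hxy
  have hd : ∀ u, dist u (φ u) ≤ (δ' - δ) / 2 := by
    intro u
    have := ((hφ u).1.trans_le (min_le_right _ _)).le
    rwa [edist_dist, ENNReal.ofReal_le_ofReal_iff (by linarith)] at this
  have he : ∀ u, edist (y.toFun u) (x.toFun (φ u)) ≤ r := fun u =>
    ((hφ u).2.trans_le (min_le_left _ _)).le
  refine ⟨φ s, φ t, ?_, ?_⟩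
  · have := dist_triangle4 (φ s) s t (φ t)
    have h1 := hd s
    rw [dist_comm] at h1
    linarith [hd t]
  · by_contra hcon
    push Not at hcon
    have h1 := edist_triangle4 (y.toFun s) (x.toFun (φ s)) (x.toFun (φ t)) (y.toFun t)
    have h2 := he t
    rw [edist_comm] at h2
    have h3 : edist (y.toFun s) (y.toFun t) ≤ r + ε' + r :=
      h1.trans (add_le_add (add_le_add (he s) hcon) h2)
    have h4 : r + ε' + r = ε' + (r + r) := by ring
    rw [h4] at h3
    exact absurd (h3.trans_lt hr) (not_lt.2 hy.le)

lemma not_continuous_of_forall_mem_oscillating [PseudoEMetricSpace E] {ε : ℝ≥0∞} (hε : 0 < ε)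
    {x : SkorohodSpace T E} (hx : ∀ δ : ℝ, 0 < δ → x ∈ oscillating T ε δ) :
    ¬ Continuous x.toFun := by
  intro hc
  have hu := CompactSpace.uniformContinuous_of_continuous hc
  obtain ⟨δ, hδ, h⟩ := EMetric.uniformContinuous_iff.1 hu ε hε
  obtain ⟨d, hd0, hdδ⟩ := ENNReal.lt_iff_exists_real_btwn.1 hδ |>.imp fun d hd => hd
  have hd : 0 < d := by simpa using hdδ.1
  obtain ⟨s, t, hst, hxst⟩ := hx d hd
  have : edist s t < δ := by
    rw [edist_dist]
    exact (ENNReal.ofReal_le_ofReal hst).trans_lt hdδ.2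
  exact absurd (h this) (not_lt.2 hxst.le)

end SkorohodSpace

open SkorohodSpace in
/-- `C`-tight processes have uniformly small moduli of continuity with high probability. -/
theorem CTight.modulus {Ω E : Type*} [MeasurableSpace Ω] {P : Measure Ω} [IsProbabilityMeasure P]
    [EMetricSpace E] {T : ℝ} {Y : ℕ → ℝ → Ω → E} (hY : CTight P T Y) {ε η : ℝ≥0∞}
    (hε : 0 < ε) (hη : 0 < η) :
    ∃ δ : ℝ, 0 < δ ∧ ∃ N : ℕ, ∀ n ≥ N,
      P {ω | ∃ s ∈ Set.Icc 0 T, ∃ t ∈ Set.Icc 0 T, |s - t| ≤ δ ∧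
        ε < edist (Y n s ω) (Y n t ω)} ≤ η := by
  obtain ⟨y, hy, hyY, htight, hlim⟩ := hY
  by_contra! hcon
  -- The closure makes the set Borel, which transfers the bound to the laws, and closed, which lets
  -- the bound survive in the weak limit.
  have hP : ∀ n δ, P {ω | ∃ s ∈ Set.Icc 0 T, ∃ t ∈ Set.Icc 0 T, |s - t| ≤ δ ∧
        ε < edist (Y n s ω) (Y n t ω)} ≤ P.map (y n) (closure (oscillating T ε δ)) := by
    intro n δ
    rw [Measure.map_apply_of_aemeasurable (hy n) isClosed_closure.measurableSet]
    refine measure_mono_ae ?_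
    filter_upwards [hyY n] with ω hω
    rintro ⟨s, hs, t, ht, hst, h⟩
    refine subset_closure ⟨⟨s, hs⟩, ⟨t, ht⟩, hst, ?_⟩
    rwa [hω ⟨s, hs⟩, hω ⟨t, ht⟩]
  have hsel : ∀ k N : ℕ, ∃ n > N, η < P.map (y n)
      (closure (oscillating T ε (1 / ((k : ℝ) + 1)))) := by
    intro k N
    obtain ⟨n, hn, h⟩ := hcon (1 / ((k : ℝ) + 1)) (by positivity) (N + 1)
    exact ⟨n, hn, h.trans_le (hP n _)⟩
  obtain ⟨φ, hφ, hφη⟩ : ∃ φ : ℕ → ℕ, StrictMono φ ∧ ∀ k, η < P.map (y (φ k))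
      (closure (oscillating T ε (1 / ((k : ℝ) + 1)))) := by
    choose f hf hfη using hsel
    let φ : ℕ → ℕ := fun k => Nat.rec (f 0 0) (fun k r => f (k + 1) r) k
    refine ⟨φ, strictMono_nat_of_lt_succ fun k => hf (k + 1) (φ k), fun k => ?_⟩
    cases k with
    | zero => exact hfη 0 0
    | succ k => exact hfη (k + 1) (φ k)
  obtain ⟨ψ, ν, hψ, hν⟩ := exists_subseq_tendsto_of_isTightMeasureSet
    (fun k => (⟨P.map (y (φ k)), Measure.isProbabilityMeasure_map (hy (φ k))⟩ :
      ProbabilityMeasure (SkorohodSpace T E)))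
    (htight.subset (by rintro _ ⟨k, rfl⟩; exact ⟨φ k, rfl⟩))
  have hcont := hlim (fun k => φ (ψ k)) (hφ.comp hψ) ν hν
  have hm : ∀ m : ℕ, η ≤ (ν : Measure (SkorohodSpace T E))
      (closure (oscillating T ε (1 / ((m : ℝ) + 1)))) := by
    intro m
    refine le_trans ?_ (ProbabilityMeasure.limsup_measure_closed_le_of_tendsto hν isClosed_closure)
    refine le_limsup_of_frequently_le ?_ (by isBoundedDefault)
    refine Eventually.frequently ?_
    filter_upwards [eventually_ge_atTop m] with k hk
    refine (hφη (ψ k)).le.trans (measure_mono (closure_mono (oscillating_mono _ ?_)))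
    have : (m : ℝ) ≤ ψ k := by exact_mod_cast hk.trans (hψ.le_apply)
    gcongr
  have hanti : Antitone fun m : ℕ =>
      closure (oscillating (E := E) T ε (1 / ((m : ℝ) + 1))) := by
    intro a b hab
    refine closure_mono (oscillating_mono _ ?_)
    have : (a : ℝ) ≤ b := by exact_mod_cast hab
    gcongr
  have hinter : η ≤ (ν : Measure (SkorohodSpace T E))
      (⋂ m : ℕ, closure (oscillating T ε (1 / ((m : ℝ) + 1)))) := by
    rw [hanti.measure_iInter (fun m => isClosed_closure.measurableSet.nullMeasurableSet)
      ⟨0, measure_ne_top _ _⟩]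
    exact le_iInf hm
  have hzero : (ν : Measure (SkorohodSpace T E))
      (⋂ m : ℕ, closure (oscillating T ε (1 / ((m : ℝ) + 1)))) = 0 := by
    refine measure_mono_null ?_ (ae_iff.1 hcont)
    intro x hx
    obtain ⟨ε', hε', hε'ε⟩ := exists_between hε
    refine not_continuous_of_forall_mem_oscillating hε' fun δ hδ => ?_
    obtain ⟨m, hm⟩ := exists_nat_one_div_lt hδ
    exact mem_oscillating_of_mem_closure hε'ε hm (Set.mem_iInter.1 hx m)
  exact absurd (hzero ▸ hinter) (not_le.2 hη)

/-! ### Large deviations of sums of square integrable variables -/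

section Moments

variable {Ω : Type*} [MeasurableSpace Ω] {P : Measure Ω} [IsProbabilityMeasure P]

lemma integrable_of_abs_le {f : Ω → ℝ} (hf : Measurable f) {M : ℝ} (h : ∀ ω, |f ω| ≤ M) :
    Integrable f P :=
  Integrable.of_bound hf.aestronglyMeasurable M (ae_of_all _ h)

/-- Second and fourth moments of a sum of bounded centered independent variables. -/
theorem moments_sum_le {V : ℕ → Ω → ℝ} {M v : ℝ} (hV : ∀ k, Measurable (V k))
    (hind : iIndepFun V P) (hM : ∀ k ω, |V k ω| ≤ M) (hmean : ∀ k, ∫ ω, V k ω ∂P = 0)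
    (hvar : ∀ k, ∫ ω, V k ω ^ 2 ∂P ≤ v) (L : ℕ) :
    ∫ ω, (∑ k ∈ Finset.range L, V k ω) ^ 2 ∂P ≤ L * v ∧
    ∫ ω, (∑ k ∈ Finset.range L, V k ω) ^ 4 ∂P ≤ L * (M ^ 2 * v) + 3 * L ^ 2 * v ^ 2 := by
  induction L with
  | zero => simp
  | succ L ih =>
    obtain ⟨ih2, ih4⟩ := ih
    set S : Ω → ℝ := fun ω => ∑ k ∈ Finset.range L, V k ω with hS
    have hSm : Measurable S := Finset.measurable_sum _ fun k _ => hV k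
    have hSb : ∀ ω, |S ω| ≤ L * M := fun ω =>
      (Finset.abs_sum_le_sum_abs _ _).trans
        ((Finset.sum_le_sum fun k _ => hM k ω).trans (by simp))
    have hSV : IndepFun S (V L) P := by
      have := hind.indepFun_finsetSum_of_notMem (fun k => (hV k)) (s := Finset.range L) (i := L)
        (by simp)
      convert this using 1
      funext ω
      simp [hS]
    have hv : 0 ≤ v := (integral_nonneg fun ω => sq_nonneg (V 0 ω)).trans (hvar 0)
    have hM0 : 0 ≤ M := by
      obtain ⟨ω⟩ := Measure.nonempty_of_neZero P
      exact (abs_nonneg _).trans (hM 0 ω)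
    have hpow_int : ∀ a b : ℕ, Integrable (fun ω => S ω ^ a * V L ω ^ b) P := fun a b =>
      integrable_of_abs_le ((hSm.pow_const a).mul ((hV L).pow_const b))
        (M := (L * M) ^ a * M ^ b) fun ω => by
          rw [abs_mul, abs_pow, abs_pow]
          gcongr
          · exact hSb ω
          · exact hM L ω
    have hprod : ∀ a b : ℕ, ∫ ω, S ω ^ a * V L ω ^ b ∂P
        = (∫ ω, S ω ^ a ∂P) * ∫ ω, V L ω ^ b ∂P := fun a b =>
      IndepFun.integral_fun_mul_eq_mul_integral
        (hSV.comp (φ := fun x : ℝ => x ^ a) (ψ := fun x : ℝ => x ^ b)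
          (measurable_id.pow_const a) (measurable_id.pow_const b))
        (hSm.pow_const a).aestronglyMeasurable ((hV L).pow_const b).aestronglyMeasurable
    have hSmean : ∫ ω, S ω ∂P = 0 := by
      rw [hS, integral_finsetSum _ fun k _ => integrable_of_abs_le (hV k) (hM k)]
      exact Finset.sum_eq_zero fun k _ => hmean k
    have h11 : ∫ ω, S ω ^ 1 * V L ω ^ 1 ∂P = 0 := by rw [hprod]; simp [hmean]
    have h31 : ∫ ω, S ω ^ 3 * V L ω ^ 1 ∂P = 0 := by rw [hprod]; simp [hmean]
    have h13 : ∫ ω, S ω ^ 1 * V L ω ^ 3 ∂P = 0 := by rw [hprod]; simp [hSmean]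
    have h22 : ∫ ω, S ω ^ 2 * V L ω ^ 2 ∂P ≤ (L * v) * v := by
      rw [hprod]
      exact mul_le_mul ih2 (hvar L) (integral_nonneg fun ω => sq_nonneg _) (by positivity)
    have h04 : ∫ ω, S ω ^ 0 * V L ω ^ 4 ∂P ≤ M ^ 2 * v := by
      calc ∫ ω, S ω ^ 0 * V L ω ^ 4 ∂P ≤ ∫ ω, M ^ 2 * (S ω ^ 0 * V L ω ^ 2) ∂P := by
            refine integral_mono (hpow_int 0 4) ((hpow_int 0 2).const_mul _) fun ω => ?_
            have h1 : V L ω ^ 2 ≤ M ^ 2 := sq_le_sq' (abs_le.1 (hM L ω)).1 (abs_le.1 (hM L ω)).2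
            have h2 := mul_le_mul_of_nonneg_right h1 (sq_nonneg (V L ω))
            simp only [pow_zero, one_mul]
            calc V L ω ^ 4 = V L ω ^ 2 * V L ω ^ 2 := by ring
              _ ≤ _ := h2
        _ ≤ M ^ 2 * v := by
            rw [integral_const_mul]
            gcongr
            simpa using hvar L
    have e2 : (fun ω => (∑ k ∈ Finset.range (L + 1), V k ω) ^ 2) = fun ω =>
        S ω ^ 2 * V L ω ^ 0 + (2 * (S ω ^ 1 * V L ω ^ 1) + S ω ^ 0 * V L ω ^ 2) := by
      funext ω
      rw [Finset.sum_range_succ]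
      simp only [hS]
      ring
    have e4 : (fun ω => (∑ k ∈ Finset.range (L + 1), V k ω) ^ 4) = fun ω =>
        S ω ^ 4 * V L ω ^ 0 + (4 * (S ω ^ 3 * V L ω ^ 1) + (6 * (S ω ^ 2 * V L ω ^ 2) +
          (4 * (S ω ^ 1 * V L ω ^ 3) + S ω ^ 0 * V L ω ^ 4))) := by
      funext ω
      rw [Finset.sum_range_succ]
      simp only [hS]
      ring
    constructor
    · rw [e2, integral_add (hpow_int 2 0) (((hpow_int 1 1).const_mul 2).fun_add (hpow_int 0 2)),
        integral_add ((hpow_int 1 1).const_mul 2) (hpow_int 0 2), integral_const_mul, h11]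
      have h02 := hvar L
      simp only [pow_zero, mul_one, one_mul, mul_zero, zero_add]
      push_cast
      linarith
    · have i13 := ((hpow_int 1 3).const_mul 4).fun_add (hpow_int 0 4)
      have i22 := ((hpow_int 2 2).const_mul 6).fun_add i13
      have i31 := ((hpow_int 3 1).const_mul 4).fun_add i22
      rw [e4, integral_add (hpow_int 4 0) i31, integral_add ((hpow_int 3 1).const_mul 4) i22,
        integral_add ((hpow_int 2 2).const_mul 6) i13,
        integral_add ((hpow_int 1 3).const_mul 4) (hpow_int 0 4),
        integral_const_mul, integral_const_mul, integral_const_mul, h31, h13]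
      simp only [pow_zero, mul_one, mul_zero, zero_add] at *
      push_cast
      -- The cross term `6 * L * v ^ 2` fits into the increment `3 * ((L + 1) ^ 2 - L ^ 2) * v ^ 2`.
      nlinarith [sq_nonneg v]

lemma measureReal_lt_abs_le_fourth_moment {S : Ω → ℝ}
    (hS : Integrable (fun ω => S ω ^ 4) P) {a : ℝ} (ha : 0 < a) :
    P.real {ω | a < |S ω|} ≤ (∫ ω, S ω ^ 4 ∂P) / a ^ 4 := by
  rw [le_div_iff₀ (by positivity), mul_comm]
  refine le_trans ?_ (mul_meas_ge_le_integral_of_nonneg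
    (ae_of_all _ fun ω => (by positivity : 0 ≤ S ω ^ 4)) hS (a ^ 4))
  refine mul_le_mul_of_nonneg_left (measureReal_mono fun ω hω => ?_) (by positivity)
  have : a ^ 4 ≤ |S ω| ^ 4 := pow_le_pow_left₀ ha.le (le_of_lt hω) 4
  rwa [Even.pow_abs (by decide)] at this

/-- The truncation of `y` at level `c`. -/
def cutoff (c y : ℝ) : ℝ := if |y| ≤ c then y else 0

lemma measurable_cutoff (c : ℝ) : Measurable (cutoff c) :=
  Measurable.ite (measurableSet_le measurable_id.abs measurable_const) measurable_id
    measurable_const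

lemma abs_cutoff_le {c : ℝ} (hc : 0 ≤ c) (y : ℝ) : |cutoff c y| ≤ c := by
  unfold cutoff
  split_ifs with h
  · exact h
  · simpa

lemma cutoff_sq_le (c y : ℝ) : cutoff c y ^ 2 ≤ y ^ 2 := by
  unfold cutoff
  split_ifs
  · exact le_rfl
  · simpa using sq_nonneg y

lemma abs_sub_cutoff_le {c : ℝ} (hc : 0 < c) (y : ℝ) : |y - cutoff c y| ≤ y ^ 2 / c := by
  unfold cutoff
  split_ifs with h
  · simp only [sub_self, abs_zero]
    positivity
  · rw [sub_zero, le_div_iff₀ hc, ← sq_abs, sq]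
    exact mul_le_mul_of_nonneg_left (not_le.1 h).le (abs_nonneg _)

/-- Since the variable is centered, its truncation has minus the mean of the discarded part, and
there `|y| ≤ y ^ 2 / c`. -/
lemma abs_integral_cutoff_le {Y : Ω → ℝ} (hY : Measurable Y) (hY2 : MemLp Y 2 P)
    (hmean : ∫ ω, Y ω ∂P = 0) {c : ℝ} (hc : 0 < c) :
    |∫ ω, cutoff c (Y ω) ∂P| ≤ (∫ ω, Y ω ^ 2 ∂P) / c := by
  have hi : Integrable (fun ω => cutoff c (Y ω)) P :=
    integrable_of_abs_le ((measurable_cutoff c).comp hY) fun ω => abs_cutoff_le hc.le _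
  have hYi : Integrable Y P := hY2.integrable (by norm_num)
  have h1 : ∫ ω, cutoff c (Y ω) ∂P = - ∫ ω, (Y ω - cutoff c (Y ω)) ∂P := by
    rw [integral_sub hYi hi, hmean]
    ring
  rw [h1, abs_neg, ← integral_div]
  refine (abs_integral_le_integral_abs).trans ?_
  exact integral_mono (hYi.sub hi).abs (hY2.integrable_sq.div_const c)
    fun ω => abs_sub_cutoff_le hc _

/-- This is Chebyshev's inequality with the second moment kept restricted to the tail event; that
restricted moment vanishes by dominated convergence. It improves the usual `O(1/L²)` to `o(1/L²)`.
-/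
lemma tendsto_sq_mul_tail {Y : Ω → ℝ} (hY : Measurable Y) (hY2 : MemLp Y 2 P) {δ : ℝ}
    (hδ : 0 < δ) :
    Tendsto (fun L : ℕ => (L : ℝ) ^ 2 * P.real {ω | δ * L < |Y ω|}) atTop (𝓝 0) := by
  have hms : ∀ L : ℕ, MeasurableSet {ω | δ * L < |Y ω|} := fun L =>
    measurableSet_lt measurable_const hY.abs
  have h1 : Tendsto (fun L : ℕ => ∫ ω, Set.indicator {ω | δ * L < |Y ω|} (fun ω => Y ω ^ 2) ω ∂P)
      atTop (𝓝 (∫ _, (0 : ℝ) ∂P)) := by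
    refine tendsto_integral_of_dominated_convergence (fun ω => Y ω ^ 2)
      (fun L => ((hY.pow_const 2).indicator (hms L)).aestronglyMeasurable) hY2.integrable_sq
      (fun L => ae_of_all _ fun ω => ?_) (ae_of_all _ fun ω => ?_)
    · rw [Real.norm_eq_abs]
      by_cases h : ω ∈ {ω | δ * L < |Y ω|}
      · rw [Set.indicator_of_mem h, abs_of_nonneg (sq_nonneg _)]
      · rw [Set.indicator_of_notMem h, abs_zero]
        exact sq_nonneg _
    · refine tendsto_const_nhds.congr' ?_
      have : Tendsto (fun L : ℕ => δ * L) atTop atTop :=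
        tendsto_natCast_atTop_atTop.const_mul_atTop hδ
      filter_upwards [this.eventually_ge_atTop |Y ω|] with L hL
      rw [Set.indicator_of_notMem]
      exact not_lt.2 hL
  rw [integral_zero] at h1
  have h2 := h1.const_mul (δ ^ 2)⁻¹
  rw [mul_zero] at h2
  refine squeeze_zero (fun L => by positivity) (fun L => ?_) h2
  have h3 : (δ * L) ^ 2 * P.real {ω | δ * L < |Y ω|}
      ≤ ∫ ω, Set.indicator {ω | δ * L < |Y ω|} (fun ω => Y ω ^ 2) ω ∂P := by
    have h4 : (δ * L) ^ 2 * P.real {ω | δ * L < |Y ω|}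
        = ∫ ω, Set.indicator {ω | δ * L < |Y ω|} (fun _ => (δ * L) ^ 2) ω ∂P := by
      rw [integral_indicator_const _ (hms L), smul_eq_mul, mul_comm]
    rw [h4]
    refine integral_mono ((integrable_const _).indicator (hms L))
      (hY2.integrable_sq.indicator (hms L)) fun ω => ?_
    refine Set.indicator_le_indicator' fun h => ?_
    rw [← sq_abs (Y ω)]
    exact pow_le_pow_left₀ (by positivity) (le_of_lt h) 2
  rw [inv_mul_eq_div, le_div_iff₀ (by positivity)]
  calc _ = (δ * L) ^ 2 * P.real {ω | δ * L < |Y ω|} := by ring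
    _ ≤ _ := h3

/-- For centered square integrable i.i.d. variables `P(|Y₁ + ⋯ + Y_L| > ε L) = o(1/L)`, with a
rate that depends on the common distribution only. -/
theorem exists_forall_mul_measureReal_sum_le {Y₀ : Ω → ℝ} (hY₀ : Measurable Y₀)
    (hY₀2 : MemLp Y₀ 2 P) (hmean : ∫ ω, Y₀ ω ∂P = 0) {ε η : ℝ} (hε : 0 < ε) (hη : 0 < η) :
    ∃ L₀ : ℕ, ∀ L ≥ L₀, ∀ Y : ℕ → Ω → ℝ, (∀ k, Measurable (Y k)) → iIndepFun Y P →
      (∀ k, IdentDistrib (Y k) Y₀ P P) →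
      L * P.real {ω | ε * L < |∑ k ∈ Finset.range L, Y k ω|} ≤ η := by
  set v := ∫ ω, Y₀ ω ^ 2 ∂P with hv
  have hv0 : 0 ≤ v := integral_nonneg fun ω => sq_nonneg _
  -- Truncating at `δ * L` leaves in `L` times the fourth moment bound a term `64 * δ ^ 2 * v / ε ^
  -- 4` that does not decay in `L`; this `δ` makes it at most `η / 3`. The other two thirds are for
  -- a large single variable and for the term of order `1 / L`.
  set δ := √(ε ^ 4 * η / (192 * (v + 1))) with hδdef
  have hδ : 0 < δ := Real.sqrt_pos.2 (by positivity)
  have hδ2 : 64 * δ ^ 2 * v / ε ^ 4 ≤ η / 3 := by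
    rw [hδdef, Real.sq_sqrt (by positivity), div_le_iff₀ (by positivity)]
    have : v / (v + 1) ≤ 1 := by rw [div_le_one (by positivity)]; linarith
    calc 64 * (ε ^ 4 * η / (192 * (v + 1))) * v = (η / 3 * ε ^ 4) * (v / (v + 1)) := by
          field_simp
          ring
      _ ≤ (η / 3 * ε ^ 4) * 1 := by gcongr
      _ = _ := mul_one _
  have hNat : Tendsto (fun L : ℕ => (L : ℝ)) atTop atTop := tendsto_natCast_atTop_atTop
  have e1 := (tendsto_sq_mul_tail hY₀ hY₀2 hδ).eventually (ge_mem_nhds (by positivity : 0 < η / 3))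
  have e2 := hNat.eventually_ge_atTop (2 * v / (δ * ε))
  have e3 := hNat.eventually_ge_atTop (144 * v ^ 2 / (ε ^ 4 * η))
  have e4 := hNat.eventually_ge_atTop 1
  have e5 := hNat.eventually_ge_atTop (√v / δ)
  obtain ⟨L₀, hL₀⟩ := eventually_atTop.1 (e1.and (e2.and (e3.and (e4.and e5))))
  refine ⟨L₀, fun L hL Y hYm hYi hYd => ?_⟩
  obtain ⟨h1, h2, h3, h4, h5⟩ := hL₀ L hL
  have hLpos : (0 : ℝ) < L := by linarith
  have hc : 0 < δ * L := by positivity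
  set c := δ * L with hcdef
  set m := ∫ ω, cutoff c (Y₀ ω) ∂P with hm
  have hm1 : |m| ≤ v / c := abs_integral_cutoff_le hY₀ hY₀2 hmean hc
  have hcv : v ≤ c ^ 2 := by
    rw [div_le_iff₀ hδ] at h5
    have := (Real.sqrt_le_left hc.le).1 (by rw [hcdef]; linarith : √v ≤ c)
    exact this
  have hm2 : |m| ≤ c := hm1.trans (by rw [div_le_iff₀ hc]; nlinarith)
  have hm3 : L * |m| ≤ ε * L / 2 := by
    rw [div_le_iff₀ (by positivity)] at h2
    calc L * |m| ≤ L * (v / c) := by gcongr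
      _ = v / δ := by rw [hcdef]; field_simp
      _ ≤ ε * L / 2 := by rw [div_le_iff₀ hδ]; linarith
  set V : ℕ → Ω → ℝ := fun k ω => cutoff c (Y k ω) - m with hV
  have hVm : ∀ k, Measurable (V k) := fun k =>
    ((measurable_cutoff c).comp (hYm k)).sub measurable_const
  have hVi : iIndepFun V P := hYi.comp (fun _ y => cutoff c y - m)
    fun _ => (measurable_cutoff c).sub measurable_const
  have hVb : ∀ k ω, |V k ω| ≤ 2 * c := fun k ω => by
    have := abs_sub (cutoff c (Y k ω)) m
    have := abs_cutoff_le hc.le (Y k ω)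
    simp only [hV]
    linarith
  have hcut : ∀ k, Integrable (fun ω => cutoff c (Y k ω)) P := fun k =>
    integrable_of_abs_le ((measurable_cutoff c).comp (hYm k)) fun ω => abs_cutoff_le hc.le _
  have hcut2 : ∀ k, Integrable (fun ω => cutoff c (Y k ω) ^ 2) P := fun k =>
    integrable_of_abs_le (((measurable_cutoff c).comp (hYm k)).pow_const 2) (M := c ^ 2)
      fun ω => by
        rw [abs_pow]
        exact pow_le_pow_left₀ (abs_nonneg _) (abs_cutoff_le hc.le _) 2
  have hcutm : ∀ k, ∫ ω, cutoff c (Y k ω) ∂P = m := fun k =>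
    ((hYd k).comp (measurable_cutoff c)).integral_eq
  have hVmean : ∀ k, ∫ ω, V k ω ∂P = 0 := fun k => by
    simp only [hV]
    rw [integral_sub (hcut k) (integrable_const _), hcutm]
    simp
  have hVvar : ∀ k, ∫ ω, V k ω ^ 2 ∂P ≤ v := fun k => by
    have e : (fun ω => V k ω ^ 2) = fun ω =>
        cutoff c (Y k ω) ^ 2 - (2 * m * cutoff c (Y k ω) - m ^ 2) := by
      funext ω
      simp only [hV]
      ring
    have hY2 : ∫ ω, Y k ω ^ 2 ∂P = v := ((hYd k).comp (measurable_id.pow_const 2)).integral_eq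
    have hYint : Integrable (fun ω => Y k ω ^ 2) P :=
      (((hYd k).comp (measurable_id.pow_const 2)).integrable_iff).2 hY₀2.integrable_sq
    have hle : ∫ ω, cutoff c (Y k ω) ^ 2 ∂P ≤ v := by
      rw [← hY2]
      exact integral_mono (hcut2 k) hYint fun ω => cutoff_sq_le _ _
    have hlin : Integrable (fun ω => 2 * m * cutoff c (Y k ω) - m ^ 2) P :=
      ((hcut k).const_mul _).sub (integrable_const _)
    rw [e, integral_sub (hcut2 k) hlin,
      integral_sub ((hcut k).const_mul _) (integrable_const _), integral_const_mul, hcutm]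
    simp only [integral_const, probReal_univ, smul_eq_mul, one_mul]
    nlinarith [sq_nonneg m]
  have hmom := (moments_sum_le hVm hVi hVb hVmean hVvar L).2
  have hS4 : Integrable (fun ω => (∑ k ∈ Finset.range L, V k ω) ^ 4) P := by
    refine integrable_of_abs_le ((Finset.measurable_sum _ fun k _ => hVm k).pow_const 4)
      (M := (L * (2 * c)) ^ 4) fun ω => ?_
    rw [abs_pow]
    refine pow_le_pow_left₀ (abs_nonneg _) ?_ 4
    exact (Finset.abs_sum_le_sum_abs _ _).trans
      ((Finset.sum_le_sum fun k _ => hVb k ω).trans (by simp))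
  have hmarkov := measureReal_lt_abs_le_fourth_moment hS4 (a := ε * L / 2) (by positivity)
  -- Either some variable exceeds the truncation level, or truncation changes nothing and the
  -- centered sum is large: recentering shifts it by `L * m`, at most half of `ε * L`.
  have hsub : {ω | ε * L < |∑ k ∈ Finset.range L, Y k ω|} ⊆
      (⋃ k ∈ Finset.range L, {ω | c < |Y k ω|}) ∪
        {ω | ε * L / 2 < |∑ k ∈ Finset.range L, V k ω|} := by
    intro ω hω
    by_cases hk : ∃ k ∈ Finset.range L, c < |Y k ω|
    · left
      simpa using hk
    · right
      push Not at hk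
      have hsum : ∑ k ∈ Finset.range L, Y k ω = ∑ k ∈ Finset.range L, V k ω + L * m := by
        simp only [hV, Finset.sum_sub_distrib, Finset.sum_const, Finset.card_range, nsmul_eq_mul]
        rw [sub_add_cancel]
        refine Finset.sum_congr rfl fun k hkL => ?_
        rw [cutoff, if_pos (hk k hkL)]
      have hω' : ε * L < |∑ k ∈ Finset.range L, Y k ω| := hω
      rw [hsum] at hω'
      have := abs_add_le (∑ k ∈ Finset.range L, V k ω) (L * m)
      rw [abs_mul, abs_of_pos hLpos] at this
      change ε * L / 2 < _
      linarith
  have htail : ∀ k, P.real {ω | c < |Y k ω|} = P.real {ω | c < |Y₀ ω|} := fun k => by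
    have := (hYd k).measure_mem_eq (s := {y : ℝ | c < |y|})
      (measurableSet_lt measurable_const measurable_id.abs)
    exact congrArg ENNReal.toReal this
  have hunion : P.real (⋃ k ∈ Finset.range L, {ω | c < |Y k ω|}) ≤ L * P.real {ω | c < |Y₀ ω|} := by
    refine (measureReal_biUnion_finset_le _ _).trans ?_
    simp [htail]
  have htotal : P.real {ω | ε * L < |∑ k ∈ Finset.range L, Y k ω|} ≤
      L * P.real {ω | c < |Y₀ ω|} +
        (L * ((2 * c) ^ 2 * v) + 3 * L ^ 2 * v ^ 2) / (ε * L / 2) ^ 4 := by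
    refine (measureReal_mono hsub).trans ((measureReal_union_le _ _).trans ?_)
    refine add_le_add hunion (hmarkov.trans ?_)
    gcongr
  have hfin : L * ((L * ((2 * c) ^ 2 * v) + 3 * L ^ 2 * v ^ 2) / (ε * L / 2) ^ 4)
      = 64 * δ ^ 2 * v / ε ^ 4 + 48 * v ^ 2 / (ε ^ 4 * L) := by
    rw [hcdef]
    field_simp
    ring
  have h6 : 48 * v ^ 2 / (ε ^ 4 * L) ≤ η / 3 := by
    rw [div_le_iff₀ (by positivity)] at h3 ⊢
    linarith
  calc L * P.real {ω | ε * L < |∑ k ∈ Finset.range L, Y k ω|}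
      ≤ L * (L * P.real {ω | c < |Y₀ ω|} +
        (L * ((2 * c) ^ 2 * v) + 3 * L ^ 2 * v ^ 2) / (ε * L / 2) ^ 4) := by gcongr
    _ = L ^ 2 * P.real {ω | c < |Y₀ ω|} +
        (64 * δ ^ 2 * v / ε ^ 4 + 48 * v ^ 2 / (ε ^ 4 * L)) := by
      rw [mul_add, hfin]
      ring
    _ ≤ η / 3 + (η / 3 + η / 3) := by gcongr
    _ = η := by ring

end Moments

/-! ### Uniform control of the increments of a random walk -/

lemma abs_block_increment_le {σ : ℕ → ℝ} {g N : ℕ} {ε : ℝ}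
    (h : ∀ a < N, |σ (g * (a + 1)) - σ (g * a) - g| ≤ ε * g) {a b : ℕ} (hab : a ≤ b) (hb : b ≤ N) :
    |σ (g * b) - σ (g * a) - g * ((b : ℝ) - a)| ≤ ε * (g * ((b : ℝ) - a)) := by
  induction b, hab using Nat.le_induction with
  | base => simp
  | succ b hab ih =>
    have h1 := ih (by omega)
    have h2 := h b (by omega)
    rw [abs_le] at h1 h2 ⊢
    push_cast
    constructor <;> nlinarith

/-- If the increments of a nondecreasing sequence over the blocks of a grid are close to the block
length, then all its increments are close to their length. -/
lemma abs_increment_le_of_blocks {σ : ℕ → ℝ} (hσ : Monotone σ) {g N : ℕ} (hg : 0 < g) {ε : ℝ}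
    (hε : 0 ≤ ε) (h : ∀ a < N, |σ (g * (a + 1)) - σ (g * a) - g| ≤ ε * g) {j k : ℕ} (hjk : j ≤ k)
    (hk : k < g * N) :
    |σ k - σ j - ((k : ℝ) - j)| ≤ 2 * g + ε * (((k : ℝ) - j) + 2 * g) := by
  have hg' : (0 : ℝ) < g := by exact_mod_cast hg
  set a := j / g with ha
  set b := k / g with hb
  have hab : a ≤ b := Nat.div_le_div_right hjk
  have hbN : b < N := Nat.div_lt_of_lt_mul hk
  have ha1 : g * a ≤ j := Nat.mul_div_le j g
  have ha2 : j ≤ g * (a + 1) := (Nat.lt_mul_div_succ j hg).le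
  have hb1 : g * b ≤ k := Nat.mul_div_le k g
  have hb2 : k ≤ g * (b + 1) := (Nat.lt_mul_div_succ k hg).le
  have hja : (g : ℝ) * a ≤ j := by exact_mod_cast ha1
  have hja' : (j : ℝ) ≤ g * (a + 1) := by exact_mod_cast ha2
  have hkb : (g : ℝ) * b ≤ k := by exact_mod_cast hb1
  have hkb' : (k : ℝ) ≤ g * (b + 1) := by exact_mod_cast hb2
  have hjk' : (j : ℝ) ≤ k := by exact_mod_cast hjk
  have hu := abs_block_increment_le h (show a ≤ b + 1 by omega) (show b + 1 ≤ N by omega)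
  rw [abs_le] at hu
  have hu2 := hu.2
  push_cast at hu2
  have hl1 := hσ ha1
  have hl2 := hσ hb2
  rw [abs_le]
  constructor
  -- The upper bound uses the blocks that cover the window, the lower bound those contained in it.
  -- If both ends lie in one block, no boundary point separates them and monotonicity suffices, the
  -- window being no longer than a block.
  · rcases Nat.lt_or_ge a b with hlt | hge
    · have hl := abs_block_increment_le h (show a + 1 ≤ b by omega) hbN.le
      rw [abs_le] at hl
      have hl1' := hl.1
      push_cast at hl1'
      have h1 := hσ ha2
      have h2 := hσ hb1
      have h3 : (g : ℝ) * (b - (a + 1)) ≤ k - j + 2 * g := by nlinarith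
      have h4 := mul_le_mul_of_nonneg_left h3 hε
      nlinarith
    · have hab' : b = a := le_antisymm hge hab
      have h1 := hσ hjk
      have h2 : (0 : ℝ) ≤ ε * (k - j + 2 * g) := mul_nonneg hε (by linarith)
      rw [hab'] at hkb'
      nlinarith
  · have h3 : (g : ℝ) * (b + 1 - a) ≤ k - j + 2 * g := by nlinarith
    have h4 := mul_le_mul_of_nonneg_left h3 hε
    nlinarith

section Walk

variable {Ω : Type*} [MeasurableSpace Ω] {P : Measure Ω} [IsProbabilityMeasure P]

/-- For a random walk with nonnegative i.i.d. square integrable steps of mean one, uniformly over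
the windows of length `O(√n)` among the first `O(n)` steps, the increments differ from their means
by `o(√n)`. -/
theorem tendsto_measure_increment_gt {ξ : ℕ → Ω → ℝ} (hξ : ∀ k, Measurable (ξ k))
    (hpos : ∀ k ω, 0 ≤ ξ k ω) (hind : iIndepFun ξ P) (hid : ∀ k, IdentDistrib (ξ k) (ξ 0) P P)
    (hL2 : MemLp (ξ 0) 2 P) (hmean : ∫ ω, ξ 0 ω ∂P = 1) {C K ε : ℝ} (hC : 0 < C) (hK : 0 < K)
    (hε : 0 < ε) :
    Tendsto (fun n : ℕ => P {ω | ∃ j k : ℕ, j ≤ k ∧ (j : ℝ) ≤ C * n ∧ (k : ℝ) - j ≤ K * √n ∧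
      ε * √n < |∑ l ∈ Finset.range k, ξ l ω - ∑ l ∈ Finset.range j, ξ l ω - ((k : ℝ) - j)|})
      atTop (𝓝 0) := by
  -- Blocks have length `g ≤ 2 * c * √n = ε * √n / 4`, so the boundary error `2 * g` is at most half
  -- the allowance. The value of `ε'` makes the accumulated block errors at most the other half, and
  -- `H` is such that more than `H * g` blocks cover `(C + K) * n` steps.
  set c := ε / 8 with hc
  have hc0 : 0 < c := by positivity
  set ε' := ε / (2 * K + ε) with hε'
  have hε_pos' : 0 < ε' := by positivity
  set H := (C + K) / c ^ 2 with hH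
  have hH0 : 0 < H := by positivity
  rw [ENNReal.tendsto_nhds_zero]
  intro η hη
  obtain ⟨η', hη_pos', hη'⟩ : ∃ η' : ℝ, 0 < η' ∧ ENNReal.ofReal η' ≤ η := by
    obtain ⟨r, hr0, hr⟩ := ENNReal.lt_iff_exists_real_btwn.1 hη
    exact ⟨r, by simpa using hr.1, hr.2.le⟩
  obtain ⟨L₀, hL₀⟩ := exists_forall_mul_measureReal_sum_le (P := P) (Y₀ := fun ω => ξ 0 ω - 1)
    ((hξ 0).sub measurable_const) (hL2.sub (memLp_const 1))
    (by rw [integral_sub (hL2.integrable (by norm_num)) (integrable_const _), hmean]; simp)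
    hε_pos' (show 0 < η' / (H + 2) by positivity)
  have hsq : Tendsto (fun n : ℕ => √(n : ℝ)) atTop atTop :=
    Real.tendsto_sqrt_atTop.comp tendsto_natCast_atTop_atTop
  filter_upwards [hsq.eventually_ge_atTop (1 / c), hsq.eventually_ge_atTop (L₀ / c),
    eventually_ge_atTop 1] with n hn1 hn2 hn3
  rw [div_le_iff₀ hc0] at hn1 hn2
  set g : ℕ := ⌈√(n : ℝ) * c⌉₊ with hg
  have hg1 : √(n : ℝ) * c ≤ g := Nat.le_ceil _
  have hg2 : (g : ℝ) ≤ 2 * (√(n : ℝ) * c) := by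
    have := Nat.ceil_lt_add_one (show 0 ≤ √(n : ℝ) * c by positivity)
    linarith
  have hgpos : (0 : ℝ) < g := by linarith
  have hgL : L₀ ≤ g := by exact_mod_cast hn2.trans hg1
  have hn1' : (1 : ℝ) ≤ n := by exact_mod_cast hn3
  have hs1 : 1 ≤ √(n : ℝ) := by rw [Real.one_le_sqrt]; exact hn1'
  have hss : √(n : ℝ) * √n = n := Real.mul_self_sqrt (by positivity)
  set N : ℕ := ⌊H * g⌋₊ + 1 with hN
  have hN1 : H * g < N := by rw [hN]; push_cast; exact Nat.lt_floor_add_one _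
  have hN2 : (N : ℝ) ≤ (H + 2) * g := by
    have := Nat.floor_le (show 0 ≤ H * (g : ℝ) by positivity)
    rw [hN]
    push_cast
    linarith
  -- The threshold `L₀` depends on the common law only, so it serves every shifted block. The factor
  -- `1 / g` offsets the number of blocks, at most `(H + 2) * g`.
  have hbad : ∀ a : ℕ, P.real {ω | ε' * g < |∑ k ∈ Finset.range g, (ξ (g * a + k) ω - 1)|}
      ≤ η' / (H + 2) / g := by
    intro a
    rw [le_div_iff₀ hgpos, mul_comm]
    refine hL₀ g hgL (fun k ω => ξ (g * a + k) ω - 1) (fun k => (hξ _).sub measurable_const) ?_ ?_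
    · have h1 : iIndepFun (fun k => ξ (g * a + k)) P :=
        hind.precomp (g := fun k => g * a + k) (fun _ _ h => by simpa using h)
      exact h1.comp (fun _ x => x - 1) fun _ => measurable_id.sub measurable_const
    · intro k
      exact (hid _).comp (u := fun x : ℝ => x - 1) (measurable_id.sub measurable_const)
  have hsub : {ω | ∃ j k : ℕ, j ≤ k ∧ (j : ℝ) ≤ C * n ∧ (k : ℝ) - j ≤ K * √n ∧
      ε * √n < |∑ l ∈ Finset.range k, ξ l ω - ∑ l ∈ Finset.range j, ξ l ω - ((k : ℝ) - j)|}
      ⊆ ⋃ a ∈ Finset.range N, {ω | ε' * g < |∑ k ∈ Finset.range g, (ξ (g * a + k) ω - 1)|} := by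
    rintro ω ⟨j, k, hjk, hj, hkj, hlt⟩
    by_contra hcon
    simp only [Set.mem_iUnion, Set.mem_ofPred_eq, not_exists, not_lt, Finset.mem_range] at hcon
    have hblock : ∀ a < N, |∑ l ∈ Finset.range (g * (a + 1)), ξ l ω
        - ∑ l ∈ Finset.range (g * a), ξ l ω - g| ≤ ε' * g := by
      intro a ha
      have := hcon a ha
      rw [Finset.sum_sub_distrib] at this
      simp only [Finset.sum_const, Finset.card_range, nsmul_eq_mul, mul_one] at this
      rwa [mul_add, mul_one, Finset.sum_range_add, add_sub_cancel_left]
    have hmono : Monotone fun l => ∑ i ∈ Finset.range l, ξ i ω := fun a b hab =>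
      Finset.sum_le_sum_of_subset_of_nonneg (Finset.range_mono hab) fun i _ _ => hpos i ω
    have hkN : k < g * N := by
      have h1 : (k : ℝ) ≤ C * n + K * √n := by linarith
      have h2 : C * n + K * √n ≤ (C + K) * n := by
        have : K * √(n : ℝ) ≤ K * n := by
          gcongr
          nlinarith
        linarith
      have h3 : (C + K) * n = H * (√(n : ℝ) * c) * (√n * c) := by
        calc (C + K) * n = (C + K) * (√(n : ℝ) * √n) := by rw [hss]
          _ = _ := by
            rw [hH]
            field_simp
      have h4 : H * (√(n : ℝ) * c) * (√n * c) ≤ H * g * g := by gcongr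
      have h5 : H * g * g < g * N := by nlinarith
      exact_mod_cast (by linarith : (k : ℝ) < g * N)
    have := abs_increment_le_of_blocks hmono (by exact_mod_cast hgpos) hε_pos'.le hblock hjk hkN
    have h6 : ε' * ((k : ℝ) - j + 2 * g) ≤ ε' * ((K + ε / 2) * √n) := by
      refine mul_le_mul_of_nonneg_left ?_ hε_pos'.le
      rw [hc] at hg2
      linarith
    have h7 : ε' * ((K + ε / 2) * √n) = ε / 2 * √n := by
      rw [hε']
      field_simp
    rw [hc] at hg2
    linarith
  have hreal : P.real (⋃ a ∈ Finset.range N,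
      {ω | ε' * g < |∑ k ∈ Finset.range g, (ξ (g * a + k) ω - 1)|}) ≤ η' := by
    refine (measureReal_biUnion_finset_le _ _).trans
      ((Finset.sum_le_sum fun a _ => hbad a).trans ?_)
    simp only [Finset.sum_const, Finset.card_range, nsmul_eq_mul]
    calc (N : ℝ) * (η' / (H + 2) / g) ≤ ((H + 2) * g) * (η' / (H + 2) / g) := by gcongr
      _ = η' := by field_simp
  refine (measure_mono hsub).trans (le_trans ?_ hη')
  rw [← ENNReal.ofReal_toReal (measure_ne_top P _)]
  exact ENNReal.ofReal_le_ofReal hreal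

/-- Strong law of large numbers for steps of mean one. -/
lemma ae_tendsto_sum_div {ξ : ℕ → Ω → ℝ} (hind : iIndepFun ξ P)
    (hid : ∀ k, IdentDistrib (ξ k) (ξ 0) P P) (hL2 : MemLp (ξ 0) 2 P)
    (hmean : ∫ ω, ξ 0 ω ∂P = 1) :
    ∀ᵐ ω ∂P, Tendsto (fun n : ℕ => (∑ i ∈ Finset.range n, ξ i ω) / n) atTop (𝓝 1) := by
  have := strong_law_ae_real ξ (hL2.integrable (by norm_num))
    (fun i j hij => hind.indepFun hij) hid
  rwa [hmean] at this

lemma tendsto_sum_atTop_of_tendsto_div {x : ℕ → ℝ}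
    (h : Tendsto (fun n : ℕ => (∑ i ∈ Finset.range n, x i) / n) atTop (𝓝 1)) :
    Tendsto (fun n : ℕ => ∑ i ∈ Finset.range n, x i) atTop atTop := by
  have h1 := h.pos_mul_atTop one_pos (tendsto_natCast_atTop_atTop (R := ℝ))
  refine h1.congr' ?_
  filter_upwards [eventually_ge_atTop 1] with n hn
  have : (n : ℝ) ≠ 0 := by positivity
  field_simp

lemma tendsto_measure_not_of_ae_eventually {p : ℕ → Ω → Prop}
    (hp : ∀ n, MeasurableSet {ω | p n ω}) (h : ∀ᵐ ω ∂P, ∀ᶠ n in atTop, p n ω) :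
    Tendsto (fun n => P {ω | ¬ p n ω}) atTop (𝓝 0) := by
  have h1 : Tendsto (fun n => ∫⁻ ω, Set.indicator {ω | ¬ p n ω} 1 ω ∂P) atTop
      (𝓝 (∫⁻ _, 0 ∂P)) := by
    refine tendsto_lintegral_of_dominated_convergence 1
      (fun n => measurable_one.indicator (hp n).compl)
      (fun n => ae_of_all _ fun ω => Set.indicator_le_self' (fun _ _ => zero_le) ω) (by simp) ?_
    filter_upwards [h] with ω hω
    refine tendsto_const_nhds.congr' ?_
    filter_upwards [hω] with n hn
    rw [Set.indicator_of_notMem]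
    simpa using hn
  rw [lintegral_zero] at h1
  refine h1.congr fun n => ?_
  exact lintegral_indicator_one (hp n).compl

/-- With probability tending to one, the first `C n` steps exceed the level `c n` if `c < C`. -/
lemma tendsto_measure_sum_le {ξ : ℕ → Ω → ℝ} (hξ : ∀ k, Measurable (ξ k))
    (hind : iIndepFun ξ P) (hid : ∀ k, IdentDistrib (ξ k) (ξ 0) P P)
    (hL2 : MemLp (ξ 0) 2 P) (hmean : ∫ ω, ξ 0 ω ∂P = 1) {c C : ℝ} (hc : 0 < c) (hcC : c < C) :
    Tendsto (fun n : ℕ => P {ω | ¬ c * n < ∑ l ∈ Finset.range ⌊C * n⌋₊, ξ l ω}) atTop (𝓝 0) := by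
  refine tendsto_measure_not_of_ae_eventually
    (fun n => measurableSet_lt measurable_const (Finset.measurable_sum _ fun k _ => hξ k)) ?_
  have hC : 0 < C := hc.trans hcC
  filter_upwards [ae_tendsto_sum_div hind hid hL2 hmean] with ω hω
  have hfloor : Tendsto (fun n : ℕ => ⌊C * n⌋₊) atTop atTop :=
    tendsto_nat_floor_atTop.comp (tendsto_natCast_atTop_atTop.const_mul_atTop hC)
  have h1 : Tendsto (fun n : ℕ => (⌊C * (n : ℝ)⌋₊ : ℝ) / n) atTop (𝓝 C) :=
    (tendsto_nat_floor_mul_div_atTop hC.le).comp tendsto_natCast_atTop_atTop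
  have h2 := (hω.comp hfloor).mul h1
  rw [one_mul] at h2
  filter_upwards [h2.eventually (lt_mem_nhds hcC), eventually_ge_atTop 1,
    hfloor.eventually_ge_atTop 1] with n hn hn1 hn2
  have hn' : (0 : ℝ) < n := by exact_mod_cast hn1
  have hf : (⌊C * (n : ℝ)⌋₊ : ℝ) ≠ 0 := by
    have : (0 : ℝ) < (⌊C * (n : ℝ)⌋₊ : ℝ) := by exact_mod_cast hn2
    exact this.ne'
  simp only [Function.comp_apply] at hn
  rw [div_mul_div_cancel₀ hf, lt_div_iff₀ hn'] at hn
  exact hn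

end Walk

/-! ### Renewal counting -/

/-- Divergence of the partial sums bounds the defining set, so its supremum in `ℕ` is attained and
is not the default value `0`. -/
lemma le_renewalCount_iff {ξ : ℕ → ℝ} (hξ : ∀ k, 0 < ξ k)
    (hlim : Tendsto (fun n : ℕ => ∑ i ∈ Finset.range n, ξ i) atTop atTop) {t : ℝ} (ht : 0 ≤ t)
    (l : ℕ) : l ≤ renewalCount ξ t ↔ ∑ k ∈ Finset.range l, ξ k ≤ t := by
  have hmono : Monotone fun l => ∑ i ∈ Finset.range l, ξ i := fun a b hab =>
    Finset.sum_le_sum_of_subset_of_nonneg (Finset.range_mono hab) fun i _ _ => (hξ i).le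
  have hbdd : BddAbove {l : ℕ | ∑ k ∈ Finset.range l, ξ k ≤ t} := by
    obtain ⟨N, hN⟩ := (hlim.eventually_gt_atTop t).exists
    refine ⟨N, fun l hl => ?_⟩
    by_contra hcon
    exact absurd (hN.trans_le (hmono (not_le.1 hcon).le)) (not_lt.2 hl)
  constructor
  · intro h
    have hmem := Nat.sSup_mem (s := {l : ℕ | ∑ k ∈ Finset.range l, ξ k ≤ t})
      ⟨0, by simpa using ht⟩ hbdd
    exact (hmono h).trans hmem
  · intro h
    exact le_csSup hbdd h

/-! ### Sample paths of a single class -/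

/-- A sample path of one class: the `l`-th arrival takes place at time `α l` and is admitted if and
only if `q (l - 1) = 1`; the `l`-th departure takes place when the work `w` done for the class
reaches the level `σ l`; no work is done while the class is empty. -/
structure QueuePath where
  X0 : ℕ
  α : ℕ → ℝ
  q : ℕ → ℕ
  A : ℝ → ℕ
  σ : ℕ → ℝ
  w : ℝ → ℝ
  D : ℝ → ℕ
  B : ℝ → ℝ
  α_strictMono : StrictMono α
  q_le_one : ∀ l, q l ≤ 1
  le_A_iff : ∀ t, 0 ≤ t → ∀ l, l ≤ A t ↔ α l ≤ t
  σ_zero : σ 0 = 0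
  σ_strictMono : StrictMono σ
  w_zero : w 0 = 0
  w_monotoneOn : MonotoneOn w (Set.Ici 0)
  w_continuousOn : ContinuousOn w (Set.Ici 0)
  w_flat : ∀ s t, 0 ≤ s → s ≤ t → (∀ u, s ≤ u → u < t → B u = 0) → w s = w t
  le_D_iff : ∀ t, 0 ≤ t → ∀ l, l ≤ D t ↔ σ l ≤ w t
  idle : ∀ t, 0 ≤ t → X0 + ∑ k ∈ Finset.range (A t), q k = D t → B t = 0

namespace QueuePath

variable (p : QueuePath)

/-- The initial number of customers plus the number of customers admitted up to time `t`. -/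
def input (t : ℝ) : ℕ := p.X0 + ∑ k ∈ Finset.range (p.A t), p.q k

lemma A_mono {s t : ℝ} (hs : 0 ≤ s) (hst : s ≤ t) : p.A s ≤ p.A t :=
  (p.le_A_iff t (hs.trans hst) _).2 (((p.le_A_iff s hs _).1 le_rfl).trans hst)

lemma input_mono {s t : ℝ} (hs : 0 ≤ s) (hst : s ≤ t) : p.input s ≤ p.input t :=
  Nat.add_le_add_left (Finset.sum_le_sum_of_subset (Finset.range_mono (p.A_mono hs hst))) _

lemma D_mono {s t : ℝ} (hs : 0 ≤ s) (hst : s ≤ t) : p.D s ≤ p.D t :=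
  (p.le_D_iff t (hs.trans hst) _).2 (((p.le_D_iff s hs _).1 le_rfl).trans
    (p.w_monotoneOn hs (hs.trans hst) hst))

lemma σ_D_le {t : ℝ} (ht : 0 ≤ t) : p.σ (p.D t) ≤ p.w t := (p.le_D_iff t ht _).1 le_rfl

lemma w_lt_σ {t : ℝ} (ht : 0 ≤ t) {l : ℕ} (hl : p.D t < l) : p.w t < p.σ l := by
  by_contra h
  exact absurd ((p.le_D_iff t ht l).2 (not_lt.1 h)) (not_le.2 hl)

lemma σ_nonneg (l : ℕ) : 0 ≤ p.σ l := by
  rw [← p.σ_zero]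
  exact p.σ_strictMono.monotone (Nat.zero_le l)

lemma D_zero : p.D 0 = 0 := by
  by_contra h
  have h1 := (p.le_D_iff 0 le_rfl 1).1 (Nat.one_le_iff_ne_zero.2 h)
  rw [p.w_zero, ← p.σ_zero] at h1
  exact absurd (p.σ_strictMono zero_lt_one) (not_lt.2 h1)

lemma exists_w_eq {s t y : ℝ} (hs : 0 ≤ s) (hst : s ≤ t) (h1 : p.w s ≤ y) (h2 : y ≤ p.w t) :
    ∃ u, s ≤ u ∧ u ≤ t ∧ p.w u = y := by
  obtain ⟨u, hu, rfl⟩ := intermediate_value_Icc hst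
    (p.w_continuousOn.mono fun v hv => hs.trans hv.1) ⟨h1, h2⟩
  exact ⟨u, hu.1, hu.2, rfl⟩

/-- Departures up to and including time `t` are bounded by the input strictly before `t`. -/
theorem D_le_of_forall_input_le (m : ℕ) : ∀ t : ℝ, 0 < t →
    (∀ u, 0 ≤ u → u < t → p.input u ≤ m) → p.D t ≤ m := by
  induction m using Nat.strong_induction_on with
  | _ m ih =>
    intro t ht hin
    by_contra hcon
    have hlt := p.σ_strictMono (Nat.lt_succ_self m)
    have hwt : p.σ (m + 1) ≤ p.w t := (p.le_D_iff t ht.le _).1 (not_le.1 hcon)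
    obtain ⟨u₀, h0u₀, hu₀t, hu₀⟩ := p.exists_w_eq le_rfl ht.le
      (by rw [p.w_zero]; exact p.σ_nonneg m) (hlt.le.trans hwt)
    -- Stopping halfway through service `m + 1` keeps the departures equal to `m` between `u₀` and
    -- `u₁`. The input is then `m` as well, the class is empty and no work is done, which
    -- contradicts the growth of `w`.
    obtain ⟨u₁, hu₀₁, hu₁t, hu₁⟩ := p.exists_w_eq (y := (p.σ m + p.σ (m + 1)) / 2) h0u₀ hu₀t
      (by linarith) (by linarith)
    have hflat := p.w_flat u₀ u₁ h0u₀ hu₀₁ fun u hu0 hu1 => by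
      have hu : 0 ≤ u := h0u₀.trans hu0
      have hwu0 := p.w_monotoneOn h0u₀ hu hu0
      have hwu1 := p.w_monotoneOn hu (h0u₀.trans hu₀₁) hu1.le
      have hDu : p.D u = m := by
        refine le_antisymm ?_ ((p.le_D_iff u hu m).2 (by linarith))
        by_contra h
        have := (p.le_D_iff u hu (m + 1)).1 (not_le.1 h)
        linarith
      refine p.idle u hu ?_
      change p.input u = p.D u
      refine le_antisymm (hDu ▸ hin u hu (hu1.trans_le hu₁t)) ?_
      by_contra h
      rw [not_le] at h
      rcases hu.eq_or_lt with rfl | hupos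
      · rw [p.D_zero] at h
        omega
      -- An input below `m` at `u` would, by the induction hypothesis at that smaller level, leave
      -- fewer than `m` departures.
      · have := ih (p.input u) (hDu ▸ h) u hupos fun v hv hvu => p.input_mono hv hvu.le
        omega
    linarith

lemma D_le_input {t : ℝ} (ht : 0 ≤ t) : p.D t ≤ p.input t := by
  rcases ht.eq_or_lt with rfl | ht
  · rw [p.D_zero]
    exact Nat.zero_le _
  · exact p.D_le_of_forall_input_le _ t ht fun u hu hut => p.input_mono hu hut.le

/-- The first admission after `t`. -/
theorem exists_first_admission {t s : ℝ} (ht : 0 ≤ t) (hts : t < s)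
    (hs : p.input t < p.input s) :
    ∃ a, t < a ∧ a ≤ s ∧ {s | t < s ∧ p.input t < p.input s} = Set.Ici a ∧
      p.input a = p.input t + 1 ∧ ∀ u, 0 ≤ u → u < a → p.input u ≤ p.input t := by
  have hex : ∃ l, p.A t ≤ l ∧ p.q l ≠ 0 := by
    by_contra hcon
    push Not at hcon
    have hA := p.A_mono ht hts.le
    have : ∑ k ∈ Finset.range (p.A s), p.q k = ∑ k ∈ Finset.range (p.A t), p.q k := by
      rw [← Finset.sum_range_add_sum_Ico _ hA, Finset.sum_eq_zero (s := Finset.Ico _ _)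
        fun k hk => hcon k (Finset.mem_Ico.1 hk).1, add_zero]
    unfold input at hs
    omega
  classical
  set l := Nat.find hex with hl
  obtain ⟨hl1, hl2⟩ := Nat.find_spec hex
  have hq : p.q l = 1 := le_antisymm (p.q_le_one l) (Nat.one_le_iff_ne_zero.2 hl2)
  have hmin : ∀ k, p.A t ≤ k → k < l → p.q k = 0 := by
    intro k hk hkl
    have := Nat.find_min hex hkl
    by_contra h
    exact this ⟨hk, h⟩
  have hsum : ∀ k, p.A t ≤ k → k ≤ l → ∑ i ∈ Finset.range k, p.q i
      = ∑ i ∈ Finset.range (p.A t), p.q i := by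
    intro k hk hkl
    rw [← Finset.sum_range_add_sum_Ico _ hk, Finset.sum_eq_zero (s := Finset.Ico _ _)
      fun i hi => hmin i (Finset.mem_Ico.1 hi).1 ((Finset.mem_Ico.1 hi).2.trans_le hkl), add_zero]
  have hta : t < p.α (l + 1) := by
    by_contra h
    have := (p.le_A_iff t ht (l + 1)).2 (not_lt.1 h)
    omega
  have ha0 : 0 ≤ p.α (l + 1) := ht.trans hta.le
  have hbefore : ∀ u, 0 ≤ u → u < p.α (l + 1) → p.input u ≤ p.input t := by
    intro u hu hua
    have hAu : p.A u ≤ l := by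
      by_contra h
      exact absurd ((p.le_A_iff u hu (l + 1)).1 (not_le.1 h)) (not_le.2 hua)
    unfold input
    refine Nat.add_le_add_left ?_ _
    rw [← hsum l hl1 le_rfl]
    exact Finset.sum_le_sum_of_subset (Finset.range_mono hAu)
  -- Arrival times are strictly increasing, so exactly one customer enters at this instant.
  have hAa : p.A (p.α (l + 1)) = l + 1 := by
    refine le_antisymm ?_ ((p.le_A_iff _ ha0 _).2 le_rfl)
    by_contra h
    have := (p.le_A_iff _ ha0 (l + 2)).1 (not_le.1 h)
    exact absurd (p.α_strictMono (Nat.lt_succ_self (l + 1))) (not_lt.2 this)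
  have hina : p.input (p.α (l + 1)) = p.input t + 1 := by
    unfold input
    rw [hAa, Finset.sum_range_succ, hsum l hl1 le_rfl, hq, add_assoc]
  refine ⟨p.α (l + 1), hta, ?_, ?_, hina, hbefore⟩
  · by_contra h
    exact absurd (hbefore s (ht.trans hts.le) (not_le.1 h)) (not_le.2 hs)
  · ext u
    constructor
    · rintro ⟨htu, hu⟩
      by_contra h
      exact absurd (hbefore u (ht.trans htu.le) (not_le.1 h)) (not_le.2 hu)
    · intro hu
      refine ⟨hta.trans_le hu, ?_⟩
      have := p.input_mono ha0 hu
      omega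

/-- The first time at which the departures reach a level. -/
theorem w_sInf_eq {m : ℕ} {s : ℝ} (hs0 : 0 ≤ s) (hs : p.σ m ≤ p.w s) :
    0 ≤ sInf {s | 0 ≤ s ∧ m ≤ p.D s} ∧ sInf {s | 0 ≤ s ∧ m ≤ p.D s} ≤ s ∧
      p.w (sInf {s | 0 ≤ s ∧ m ≤ p.D s}) = p.σ m := by
  have hset : {s | 0 ≤ s ∧ m ≤ p.D s} = Set.Ici 0 ∩ p.w ⁻¹' Set.Ici (p.σ m) := by
    ext u
    constructor
    · rintro ⟨hu, h⟩
      exact ⟨hu, (p.le_D_iff u hu m).1 h⟩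
    · rintro ⟨hu, h⟩
      exact ⟨hu, (p.le_D_iff u hu m).2 h⟩
  have hclosed : IsClosed (Set.Ici (0 : ℝ) ∩ p.w ⁻¹' Set.Ici (p.σ m)) :=
    p.w_continuousOn.preimage_isClosed_of_isClosed isClosed_Ici isClosed_Ici
  have hbdd : BddBelow (Set.Ici (0 : ℝ) ∩ p.w ⁻¹' Set.Ici (p.σ m)) := ⟨0, fun u hu => hu.1⟩
  rw [hset]
  obtain ⟨u, hu0, hus, hu⟩ := p.exists_w_eq le_rfl hs0 (by rw [p.w_zero]; exact p.σ_nonneg m) hs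
  have hmem := hclosed.csInf_mem ⟨s, hs0, hs⟩ hbdd
  have hle : sInf (Set.Ici (0 : ℝ) ∩ p.w ⁻¹' Set.Ici (p.σ m)) ≤ u :=
    csInf_le hbdd ⟨hu0, hu.ge⟩
  refine ⟨hmem.1, hle.trans hus, le_antisymm ?_ hmem.2⟩
  exact (p.w_monotoneOn hmem.1 hu0 hle).trans hu.le

/-- A pathwise form of the Little law at the diffusion scale `r = √n`. -/
theorem abs_queue_sub_le {r lam ε c K C T T' : ℝ} (hc : 0 ≤ c) (hK : 0 ≤ K)
    (hε : 0 < ε) (hr1 : 1 ≤ r) (hr : 1 ≤ ε * r) (hcK : K + 6 * ε ≤ lam * c)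
    (hTT : T + 2 * (c / r) ≤ T')
    (hw : ∀ s h, 0 ≤ s → 0 ≤ h → h ≤ c / r → s + h ≤ T' →
      |p.w (s + h) - p.w s - lam * r ^ 2 * h| ≤ 2 * ε * r)
    (hσ : ∀ j k : ℕ, j ≤ k → (j : ℝ) ≤ C → (k : ℝ) - j ≤ (K + 2) * r →
      |p.σ k - p.σ j - ((k : ℝ) - j)| ≤ ε * r)
    (hD : ∀ s, 0 ≤ s → s ≤ T' → (p.D s : ℝ) ≤ C) {t : ℝ} (ht0 : 0 ≤ t) (htT : t ≤ T)
    (hx : (p.input t : ℝ) - p.D t ≤ K * r) {a d : ℝ}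
    (ha : a = sInf {s | t < s ∧ p.input t < p.input s})
    (hd : d = sInf {s | 0 ≤ s ∧ p.input a ≤ p.D s}) :
    {s | t < s ∧ p.input t < p.input s}.Nonempty ∧ {s | 0 ≤ s ∧ p.input a ≤ p.D s}.Nonempty ∧
      t ≤ a ∧ a ≤ t + c / r ∧
      |(p.input a : ℝ) - p.D a - lam * r ^ 2 * (d - a)| ≤ 5 * ε * r := by
  have hr0 : 0 < r := by linarith
  have hlamc : 0 < lam * c := by linarith
  have hc0 : 0 < c := lt_of_le_of_ne hc (by rintro rfl; simp at hlamc)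
  have hcr : 0 < c / r := by positivity
  have hlcr : lam * r ^ 2 * (c / r) = lam * c * r := by field_simp
  have hlow : (K + 6 * ε) * r ≤ lam * c * r := by gcongr
  -- Without an admission in the window, at most `K * r` departures are possible, since departures
  -- never exceed the input. The work done is at least `(K + 4 * ε) * r`, whereas one customer more
  -- than these needs at most `(K + 2 * ε) * r`, the rounding `1 ≤ ε * r` included.
  have hs : p.input t < p.input (t + c / r) := by
    by_contra hcon
    rw [not_lt] at hcon
    have h1 := p.D_le_input (add_nonneg ht0 hcr.le)
    have hDts := p.D_mono ht0 (show t ≤ t + c / r by linarith)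
    have h2 : (p.D (t + c / r) : ℝ) ≤ p.input t := by exact_mod_cast h1.trans hcon
    have h3 := hσ (p.D t) (p.D (t + c / r) + 1) (by omega) (hD t ht0 (by linarith))
      (by push_cast; nlinarith)
    have h4 := hw t (c / r) ht0 hcr.le le_rfl (by linarith)
    rw [hlcr] at h4
    have h5 := p.w_lt_σ (add_nonneg ht0 hcr.le) (Nat.lt_succ_self (p.D (t + c / r)))
    have h6 := p.σ_D_le ht0
    rw [abs_le] at h3 h4
    push_cast at h3
    have h7 := h3.2
    have h8 := h4.1
    simp only [Nat.succ_eq_add_one] at h5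
    nlinarith
  obtain ⟨b, htb, hbs, hset, hinb, hbefore⟩ :=
    p.exists_first_admission ht0 (show t < t + c / r by linarith) hs
  have hab : a = b := by rw [ha, hset, csInf_Ici]
  subst hab
  have ha0 : 0 ≤ a := ht0.trans htb.le
  -- The queue bound is assumed at `t` only, and `a` may exceed `T`. As one customer enters and
  -- departures only increase, the queue at `a` is at most one larger; by this line it contains at
  -- least the customer just admitted.
  have hDa : p.D a ≤ p.input t := p.D_le_of_forall_input_le _ a (ht0.trans_lt htb) hbefore
  have hDta := p.D_mono ht0 htb.le
  have hDta' : (p.D t : ℝ) ≤ p.D a := by exact_mod_cast hDta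
  have hina : (p.input a : ℝ) = p.input t + 1 := by rw [hinb]; push_cast; ring
  have hDC := hD a ha0 (by linarith)
  have hxa : (p.input a : ℝ) - p.D a ≤ K * r + 1 := by linarith
  have hσm := hσ (p.D a) (p.input a) (by omega) hDC (by nlinarith)
  have hσ1 := hσ (p.D a) (p.D a + 1) (by omega) hDC (by push_cast; nlinarith)
  have hσDa := p.σ_D_le ha0
  have hwa := p.w_lt_σ ha0 (Nat.lt_succ_self (p.D a))
  simp only [Nat.succ_eq_add_one] at hwa
  push_cast at hσ1
  rw [abs_le] at hσm hσ1
  have hσm2 := hσm.2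
  have hreach : p.σ (p.input a) ≤ p.w (a + c / r) := by
    have h4 := hw a (c / r) ha0 hcr.le le_rfl (by linarith)
    rw [hlcr, abs_le] at h4
    have h8 := h4.1
    nlinarith
  have hac : 0 ≤ a + c / r := add_nonneg ha0 hcr.le
  obtain ⟨hd0, hds, hwd⟩ := p.w_sInf_eq hac hreach
  rw [← hd] at hd0 hds hwd
  have had : a ≤ d := by
    by_contra hcon
    have h1 := p.w_monotoneOn hd0 ha0 (not_le.1 hcon).le
    have h2 : p.σ (p.D a + 1) ≤ p.σ (p.input a) := p.σ_strictMono.monotone (by omega)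
    linarith
  refine ⟨⟨_, by linarith, hs⟩, ⟨_, hac, (p.le_D_iff _ hac _).2 hreach⟩, htb.le, hbs, ?_⟩
  have hwin := hw a (d - a) ha0 (by linarith) (by linarith) (by linarith)
  rw [add_sub_cancel, hwd, abs_le] at hwin
  rw [abs_le]
  -- The error `5 * ε * r` consists of `2 * ε * r` for the work, `ε * r` for the service times of
  -- the queue, and at most `1 + ε * r ≤ 2 * ε * r` for the part already served of the customer in
  -- service at `a`.
  constructor
  · linarith [hwin.1, hwin.2, hσm.1, hσm.2, hσ1.1, hσ1.2]
  · linarith [hwin.1, hwin.2, hσm.1, hσm.2, hσ1.1, hσ1.2]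

end QueuePath

/-! ### Paths of the effort allocation -/

/-- Sampling at the next grid point strictly to the right gives step functions, which converge to
`f` by right-continuity. With boundedness this makes the effort integrable, so `Control.busy` is a
genuine integral and not a default value. -/
lemma aestronglyMeasurable_of_isRCLL {f : ℝ → ℝ} (hf : IsRCLL fun t : Set.Ici (0 : ℝ) => f t) :
    AEStronglyMeasurable f (volume.restrict (Set.Ici 0)) := by
  refine aestronglyMeasurable_of_tendsto_ae atTop
    (f := fun (n : ℕ) t => f (((⌊t * ((n : ℝ) + 1)⌋₊ : ℝ) + 1) / ((n : ℝ) + 1))) (fun n => ?_) ?_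
  · have h1 : Measurable fun t : ℝ => ⌊t * ((n : ℝ) + 1)⌋₊ :=
      Nat.measurable_floor.comp (measurable_id.mul_const _)
    have h2 : Measurable fun k : ℕ => f (((k : ℝ) + 1) / ((n : ℝ) + 1)) := measurable_from_top
    exact (h2.comp h1).aestronglyMeasurable
  · filter_upwards [ae_restrict_mem measurableSet_Ici] with t ht
    have ht' : (0 : ℝ) ≤ t := ht
    have hn : Tendsto (fun n : ℕ => (n : ℝ) + 1) atTop atTop :=
      tendsto_atTop_add_const_right _ _ tendsto_natCast_atTop_atTop
    have h1 : Tendsto (fun n : ℕ => ((⌊t * ((n : ℝ) + 1)⌋₊ : ℝ) + 1) / ((n : ℝ) + 1)) atTop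
        (𝓝 t) := by
      have := ((tendsto_nat_floor_mul_div_atTop ht').comp hn).add
        (tendsto_const_nhds.div_atTop hn : Tendsto (fun n : ℕ => (1 : ℝ) / ((n : ℝ) + 1)) _ _)
      rw [add_zero] at this
      refine this.congr fun n => ?_
      simp only [Function.comp_apply]
      rw [← add_div]
    have hge : ∀ n : ℕ, t ≤ ((⌊t * ((n : ℝ) + 1)⌋₊ : ℝ) + 1) / ((n : ℝ) + 1) := by
      intro n
      rw [le_div_iff₀ (by positivity)]
      exact (Nat.lt_floor_add_one _).le
    have h2 : Tendsto (fun n : ℕ =>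
        (⟨((⌊t * ((n : ℝ) + 1)⌋₊ : ℝ) + 1) / ((n : ℝ) + 1), ht'.trans (hge n)⟩ : Set.Ici (0 : ℝ)))
        atTop (𝓝[≥] ⟨t, ht⟩) := by
      refine tendsto_nhdsWithin_iff.2 ⟨tendsto_subtype_rng.2 h1, Eventually.of_forall fun n => ?_⟩
      exact hge n
    exact (hf ⟨t, ht⟩).1.tendsto.comp h2

namespace Model

variable {I : ℕ} {Ω : Type*} [MeasurableSpace Ω] {P : Measure Ω} {M : Model I P}
  {n : ℕ} {U : Control I Ω}

lemma Admissible.B_le_one (hU : M.Admissible n U) (ω : Ω) (i : Fin I)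
    {t : ℝ} (ht : 0 ≤ t) : U.B t ω i ≤ 1 :=
  (Finset.single_le_sum (fun j _ => hU.B_nonneg ω j t ht) (Finset.mem_univ i)).trans
    (hU.B_sum_le ω t ht)

lemma Admissible.intervalIntegrable (hU : M.Admissible n U) (ω : Ω) (i : Fin I)
    {s t : ℝ} (hs : 0 ≤ s) (hst : s ≤ t) :
    IntervalIntegrable (fun u => U.B u ω i) volume s t := by
  rw [intervalIntegrable_iff_integrableOn_Ioc_of_le hst]
  have hrcll : IsRCLL fun t : Set.Ici (0 : ℝ) => U.B t ω i := by
    intro u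
    obtain ⟨h1, l, h2⟩ := hU.B_rcll ω u
    exact ⟨continuousWithinAt_pi.1 h1 i, l i, (tendsto_pi_nhds.1 h2) i⟩
  have hsub : Set.Ioc s t ⊆ Set.Ici 0 := fun u hu => hs.trans hu.1.le
  refine Integrable.of_bound (C := 1)
    ((aestronglyMeasurable_of_isRCLL (f := fun u => U.B u ω i) hrcll).mono_measure
      (Measure.restrict_mono hsub le_rfl)) ?_
  filter_upwards [ae_restrict_mem measurableSet_Ioc] with u hu
  rw [Real.norm_eq_abs, abs_of_nonneg (hU.B_nonneg ω i u (hsub hu))]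
  exact hU.B_le_one ω i (hsub hu)

lemma Admissible.busy_sub (hU : M.Admissible n U) (ω : Ω) (i : Fin I)
    {s t : ℝ} (hs : 0 ≤ s) (hst : s ≤ t) :
    U.busy i t ω - U.busy i s ω = ∫ u in s..t, U.B u ω i :=
  intervalIntegral.integral_interval_sub_left
    (hU.intervalIntegrable ω i le_rfl (hs.trans hst)) (hU.intervalIntegrable ω i le_rfl hs)

lemma Admissible.busy_mono (hU : M.Admissible n U) (ω : Ω) (i : Fin I)
    {s t : ℝ} (hs : 0 ≤ s) (hst : s ≤ t) :
    U.busy i s ω ≤ U.busy i t ω := by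
  rw [← sub_nonneg, hU.busy_sub ω i hs hst]
  exact intervalIntegral.integral_nonneg hst fun u hu => hU.B_nonneg ω i u (hs.trans hu.1)

lemma Admissible.busy_sub_le (hU : M.Admissible n U) (ω : Ω) (i : Fin I)
    {s t : ℝ} (hs : 0 ≤ s) (hst : s ≤ t) :
    U.busy i t ω - U.busy i s ω ≤ t - s := by
  rw [hU.busy_sub ω i hs hst]
  calc ∫ u in s..t, U.B u ω i ≤ ∫ _ in s..t, (1 : ℝ) :=
        intervalIntegral.integral_mono_on hst (hU.intervalIntegrable ω i hs hst)
          intervalIntegrable_const fun u hu => hU.B_le_one ω i (hs.trans hu.1)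
    _ = t - s := by simp

lemma Admissible.busy_flat (hU : M.Admissible n U) (ω : Ω) (i : Fin I)
    {s t : ℝ} (hs : 0 ≤ s) (hst : s ≤ t)
    (h : ∀ u, s ≤ u → u < t → U.B u ω i = 0) : U.busy i s ω = U.busy i t ω := by
  have h1 := hU.busy_sub ω i hs hst
  rw [intervalIntegral.integral_of_le hst, integral_Ioc_eq_integral_Ioo,
    setIntegral_eq_zero_of_forall_eq_zero fun u hu => h u hu.1.le hu.2] at h1
  linarith

lemma Admissible.busy_continuousOn (hU : M.Admissible n U) (ω : Ω) (i : Fin I)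
    : ContinuousOn (fun t => U.busy i t ω) (Set.Ici 0) := by
  refine (LipschitzOnWith.of_dist_le_mul (K := 1) fun s hs t ht => ?_).continuousOn
  rw [NNReal.coe_one, one_mul, Real.dist_eq, Real.dist_eq]
  rcases le_total s t with hst | hts
  · rw [abs_sub_comm, abs_sub_comm s, abs_of_nonneg (sub_nonneg.2 (hU.busy_mono ω i hs hst)),
      abs_of_nonneg (sub_nonneg.2 hst)]
    exact hU.busy_sub_le ω i hs hst
  · rw [abs_of_nonneg (sub_nonneg.2 (hU.busy_mono ω i ht hts)),
      abs_of_nonneg (sub_nonneg.2 hts)]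
    exact hU.busy_sub_le ω i ht hts

lemma IA_indep (M : Model I P) (i : Fin I) : iIndepFun (M.IA i) P :=
  M.indep.precomp (g := fun k : ℕ => Sum.inl (i, k)) (fun _ _ h => by simpa using h)

lemma ST_indep (M : Model I P) (i : Fin I) : iIndepFun (M.ST i) P :=
  M.indep.precomp (g := fun k : ℕ => Sum.inr (i, k)) (fun _ _ h => by simpa using h)

lemma strictMono_sum {x : ℕ → ℝ} (hx : ∀ k, 0 < x k) :
    StrictMono fun l => ∑ k ∈ Finset.range l, x k :=
  strictMono_nat_of_lt_succ fun l => by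
    rw [Finset.sum_range_succ]
    linarith [hx l]

/-- Almost every sample path of an admissible control is a `QueuePath`, for every class. -/
theorem Admissible.ae_exists_queuePath [IsProbabilityMeasure P] (hU : M.Admissible n U) :
    ∀ᵐ ω ∂P, ∀ i, ∃ p : QueuePath, (∀ l, p.σ l = ∑ k ∈ Finset.range l, M.ST i k ω) ∧
      (∀ t, p.w t = M.muN n i * U.busy i t ω) ∧ (∀ t, p.D t = M.D n U i t ω) ∧
      ∀ t, 0 ≤ t → (p.input t : ℝ) = M.X0 n i + M.A n i t ω - U.Z t ω i := by
  obtain ⟨z, hz01, hz⟩ := hU.rejection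
  -- The strong law enters only to exclude explosion, under which the counting processes would not
  -- invert the partial sums.
  have hIA : ∀ᵐ ω ∂P, ∀ i, Tendsto (fun n : ℕ => ∑ k ∈ Finset.range n, M.IA i k ω) atTop atTop := by
    rw [ae_all_iff]
    intro i
    filter_upwards [ae_tendsto_sum_div (M.IA_indep i) (M.IA_identDistrib i) (M.IA_memLp i)
      (M.IA_mean i)] with ω hω using tendsto_sum_atTop_of_tendsto_div hω
  have hST : ∀ᵐ ω ∂P, ∀ i, Tendsto (fun n : ℕ => ∑ k ∈ Finset.range n, M.ST i k ω) atTop atTop := by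
    rw [ae_all_iff]
    intro i
    filter_upwards [ae_tendsto_sum_div (M.ST_indep i) (M.ST_identDistrib i) (M.ST_memLp i)
      (M.ST_mean i)] with ω hω using tendsto_sum_atTop_of_tendsto_div hω
  filter_upwards [hz, hU.idle_when_empty, hIA, hST] with ω hzω hidle hIAω hSTω i
  have hlam := M.lamN_pos n i
  have hmu := M.muN_pos n i
  classical
  set q : ℕ → ℕ := fun l => if z i (M.arrivalTime n i l ω) ω = 0 then 1 else 0 with hq
  have hqz : ∀ l, (q l : ℝ) = 1 - z i (M.arrivalTime n i l ω) ω := by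
    intro l
    rcases hz01 i (M.arrivalTime n i l ω) ω with h | h <;> simp [hq, h]
  have hin : ∀ t, 0 ≤ t → (M.X0 n i : ℝ) + ∑ k ∈ Finset.range (M.A n i t ω), (q k : ℝ)
      = M.X0 n i + M.A n i t ω - U.Z t ω i := by
    intro t ht
    rw [hzω i t ht]
    simp only [hqz, Finset.sum_sub_distrib, Finset.sum_const, Finset.card_range, nsmul_eq_mul,
      mul_one]
    ring
  have hbusy0 : U.busy i 0 ω = 0 := by simp [Control.busy]
  have hbusy : ∀ t, 0 ≤ t → 0 ≤ U.busy i t ω := fun t ht => by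
    rw [← hbusy0]
    exact hU.busy_mono ω i le_rfl ht
  let p : QueuePath :=
    { X0 := M.X0 n i
      α := fun l => (∑ k ∈ Finset.range l, M.IA i k ω) / M.lamN n i
      q := q
      A := fun t => M.A n i t ω
      σ := fun l => ∑ k ∈ Finset.range l, M.ST i k ω
      w := fun t => M.muN n i * U.busy i t ω
      D := fun t => M.D n U i t ω
      B := fun t => U.B t ω i
      α_strictMono := fun a b hab =>
        div_lt_div_of_pos_right (strictMono_sum (fun k => M.IA_pos i k ω) hab) hlam
      q_le_one := fun l => by
        simp only [hq]
        split_ifs <;> simp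
      le_A_iff := fun t ht l => by
        rw [div_le_iff₀ hlam, mul_comm t]
        exact le_renewalCount_iff (fun k => M.IA_pos i k ω) (hIAω i) (by positivity) l
      σ_zero := by simp
      σ_strictMono := strictMono_sum fun k => M.ST_pos i k ω
      w_zero := by rw [hbusy0, mul_zero]
      w_monotoneOn := fun s hs t _ hst =>
        mul_le_mul_of_nonneg_left (hU.busy_mono ω i hs hst) hmu.le
      w_continuousOn := (hU.busy_continuousOn ω i).const_mul _
      w_flat := fun s t hs hst h => by rw [hU.busy_flat ω i hs hst h]
      le_D_iff := fun t ht l =>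
        le_renewalCount_iff (fun k => M.ST_pos i k ω) (hSTω i)
          (mul_nonneg hmu.le (hbusy t ht)) l
      idle := fun t ht h => by
        refine hidle i t ht ?_
        have h' : (M.X0 n i : ℝ) + ∑ k ∈ Finset.range (M.A n i t ω), (q k : ℝ) = M.D n U i t ω := by
          exact_mod_cast h
        rw [hin t ht] at h'
        unfold X
        linarith }
  refine ⟨p, fun _ => rfl, fun _ => rfl, fun _ => rfl, fun t ht => ?_⟩
  rw [← hin t ht]
  simp [QueuePath.input, p]

/-! ### The Little law on a good sample path -/

/-- The customers admitted first after the times in `[0,T]` have finite admission and departure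
times, are admitted within time `c / √n`, and obey the Little law up to `e`. -/
def LittleUpTo (M : Model I P) (n : ℕ) (U : Control I Ω) (T c e : ℝ) (ω : Ω) : Prop :=
  ∀ i, ∀ t ∈ Set.Icc (0 : ℝ) T, M.FiniteTimes n U i t ω ∧ t ≤ M.AT n U i t ω ∧
    M.AT n U i t ω ≤ t + c / √n ∧
    |M.XHat n U (M.AT n U i t ω) ω i - M.lam i * M.thetaHat n U i t ω| ≤ e

/-- By definition of `YHat`, the scaled work is `muN * (lam / mu) * t` minus `√n` times `YHat`. The
drift differs from `lam * n` by `o(n)`, over a time with `n * h ≤ c * √n`, and the modulus controls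
the rest. The divisor `c + 1` is positive even if `c = 0`. -/
lemma abs_work_increment_sub_le {i : Fin I} {ω : Ω} {c e T' : ℝ} (hn : 0 < n) (hc : 0 ≤ c)
    (hmu : |M.muN n i / n * (M.lam i / M.mu i) - M.lam i| ≤ e / (c + 1)) (he : 0 ≤ e)
    (hmod : ∀ s ∈ Set.Icc 0 T', ∀ t ∈ Set.Icc 0 T', |s - t| ≤ c / √n →
      |M.YHat n U s ω i - M.YHat n U t ω i| ≤ e)
    {s h : ℝ} (hs : 0 ≤ s) (hh : 0 ≤ h) (hhc : h ≤ c / √n) (hsh : s + h ≤ T') :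
    |M.muN n i * U.busy i (s + h) ω - M.muN n i * U.busy i s ω - M.lam i * √n ^ 2 * h|
      ≤ 2 * e * √n := by
  have hn' : (0 : ℝ) < n := by exact_mod_cast hn
  have hr : 0 < √(n : ℝ) := Real.sqrt_pos.2 hn'
  have hrr : √(n : ℝ) ^ 2 = n := Real.sq_sqrt hn'.le
  have hY := hmod (s + h) ⟨by linarith, hsh⟩ s ⟨hs, by linarith⟩
    (by rw [add_sub_cancel_left, abs_of_nonneg hh]; exact hhc)
  have hid : M.muN n i * U.busy i (s + h) ω - M.muN n i * U.busy i s ω - M.lam i * √n ^ 2 * h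
      = (M.muN n i / n * (M.lam i / M.mu i) - M.lam i) * (n * h)
        - √n * (M.YHat n U (s + h) ω i - M.YHat n U s ω i) := by
    rw [hrr]
    unfold YHat
    field_simp
    ring
  rw [hid]
  have h1 : n * h ≤ c * √n := by
    calc n * h ≤ n * (c / √n) := by gcongr
      _ = c * √n := by
        rw [mul_div_assoc', div_eq_iff hr.ne', mul_assoc, ← sq, hrr, mul_comm]
  have h2 : |(M.muN n i / n * (M.lam i / M.mu i) - M.lam i) * (n * h)| ≤ e * √n := by
    rw [abs_mul, abs_of_nonneg (by positivity : (0 : ℝ) ≤ n * h)]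
    calc _ ≤ e / (c + 1) * (c * √n) := by gcongr
      _ = e * √n * (c / (c + 1)) := by field_simp
      _ ≤ e * √n * 1 := by
        gcongr
        rw [div_le_one (by positivity)]
        linarith
      _ = _ := mul_one _
  have h3 : |√n * (M.YHat n U (s + h) ω i - M.YHat n U s ω i)| ≤ e * √n := by
    rw [abs_mul, abs_of_pos hr, mul_comm]
    gcongr
  have := abs_sub ((M.muN n i / n * (M.lam i / M.mu i) - M.lam i) * (n * h))
    (√n * (M.YHat n U (s + h) ω i - M.YHat n U s ω i))
  linarith

/-- This is the deterministic half: it transfers `QueuePath.abs_queue_sub_le` to the model. The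
hypothesis `hsum` bounds the departures up to `T'` by `C i * n`, since the scaled work done by then
is at most `muN * T'`; hence only service times covered by `hwin` matter. -/
theorem littleUpTo_of_queuePath (hU : M.Admissible n U) {ω : Ω} {c e K T T' : ℝ} {C : Fin I → ℝ}
    (hn : 0 < n) (hc : 0 ≤ c) (hK : 0 ≤ K) (he : 0 < e) (hen : 1 ≤ e * √n)
    (hcK : ∀ i, K + 6 * e ≤ M.lam i * c) (hTT : T + 2 * (c / √n) ≤ T')
    (hp : ∀ i, ∃ p : QueuePath, (∀ l, p.σ l = ∑ k ∈ Finset.range l, M.ST i k ω) ∧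
      (∀ t, p.w t = M.muN n i * U.busy i t ω) ∧ (∀ t, p.D t = M.D n U i t ω) ∧
      ∀ t, 0 ≤ t → (p.input t : ℝ) = M.X0 n i + M.A n i t ω - U.Z t ω i)
    (hmu : ∀ i, |M.muN n i / n * (M.lam i / M.mu i) - M.lam i| ≤ e / (c + 1))
    (hmod : ∀ i, ∀ s ∈ Set.Icc 0 T', ∀ t ∈ Set.Icc 0 T', |s - t| ≤ c / √n →
      |M.YHat n U s ω i - M.YHat n U t ω i| ≤ e)
    (hwin : ∀ i, ∀ j k : ℕ, j ≤ k → (j : ℝ) ≤ C i * n → (k : ℝ) - j ≤ (K + 2) * √n →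
      |∑ l ∈ Finset.range k, M.ST i l ω - ∑ l ∈ Finset.range j, M.ST i l ω - ((k : ℝ) - j)|
        ≤ e * √n)
    (hsum : ∀ i, M.muN n i * T' < ∑ l ∈ Finset.range ⌊C i * n⌋₊, M.ST i l ω)
    (hC : ∀ i, 0 ≤ C i)
    (hX : ∀ i, ∀ t ∈ Set.Icc (0 : ℝ) T, M.XHat n U t ω i ≤ K) :
    M.LittleUpTo n U T c (5 * e) ω := by
  intro i t ht
  obtain ⟨p, hpσ, hpw, hpD, hpin⟩ := hp i
  have hn' : (0 : ℝ) < n := by exact_mod_cast hn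
  have hr : 0 < √(n : ℝ) := Real.sqrt_pos.2 hn'
  have hr1 : 1 ≤ √(n : ℝ) := by
    rw [Real.one_le_sqrt]
    exact_mod_cast hn
  have hXp : ∀ s, 0 ≤ s → M.X n U i s ω = p.input s - p.D s := by
    intro s hs
    rw [hpin s hs, hpD s]
    unfold X
    ring
  have hAD : ∀ s, 0 ≤ s → M.AD n U i s ω = p.input s - M.X0 n i := by
    intro s hs
    rw [hpin s hs]
    unfold AD
    ring
  have hadm : M.admissionSet n U i t ω = {s | t < s ∧ p.input t < p.input s} := by
    ext s
    refine and_congr_right fun hts => ?_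
    rw [hAD t ht.1, hAD s (ht.1.trans hts.le), sub_lt_sub_iff_right, Nat.cast_lt]
  -- This holds also for an empty `admissionSet`, whose infimum is `0` by default, so the departure
  -- set can be rewritten before nonemptiness is known.
  have hAT0 : 0 ≤ M.AT n U i t ω := Real.sInf_nonneg fun s hs => ht.1.trans hs.1.le
  have hdep : M.departureSet n U i t ω = {s | 0 ≤ s ∧ p.input (M.AT n U i t ω) ≤ p.D s} := by
    ext s
    refine and_congr_right fun hs => ?_
    rw [hXp _ hAT0, hpD, hpD, add_sub_cancel, Nat.cast_le]
  have hXt : (p.input t : ℝ) - p.D t ≤ K * √n := by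
    have := hX i t ht
    unfold XHat at this
    rwa [div_le_iff₀ hr, hXp t ht.1] at this
  have hDC : ∀ s, 0 ≤ s → s ≤ T' → (p.D s : ℝ) ≤ C i * n := by
    intro s hs hsT
    have hfl : p.D s ≤ ⌊C i * n⌋₊ := by
      by_contra hcon
      have h1 := p.σ_strictMono (not_le.1 hcon)
      rw [hpσ ⌊C i * n⌋₊] at h1
      have h2 := p.σ_D_le hs
      have h3 : U.busy i s ω ≤ T' := by
        have := hU.busy_sub_le ω i le_rfl hs
        have h0 : U.busy i 0 ω = 0 := by simp [Control.busy]
        linarith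
      rw [hpw] at h2
      have h4 := mul_le_mul_of_nonneg_left h3 (M.muN_pos n i).le
      linarith [hsum i]
    exact (Nat.cast_le.2 hfl).trans (Nat.floor_le (mul_nonneg (hC i) hn'.le))
  obtain ⟨h1, h2, h3, h4, h5⟩ := p.abs_queue_sub_le (r := √n) (lam := M.lam i) (ε := e) (c := c)
    (K := K) (C := C i * n) (T := T) (T' := T') hc hK he hr1 hen (hcK i) hTT
    (fun s h hs hh hhc hsh => by
      rw [hpw, hpw]
      exact abs_work_increment_sub_le hn hc (hmu i) he.le (hmod i) hs hh hhc hsh)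
    (fun j k hjk hj hk => by
      rw [hpσ, hpσ]
      exact hwin i j k hjk hj hk)
    hDC ht.1 ht.2 hXt (a := M.AT n U i t ω) (d := M.DT n U i t ω)
    (by rw [← hadm]; rfl) (by rw [← hdep]; rfl)
  refine ⟨⟨hadm ▸ h1, hdep ▸ h2⟩, h3, h4, ?_⟩
  have hid : M.XHat n U (M.AT n U i t ω) ω i - M.lam i * M.thetaHat n U i t ω
      = ((p.input (M.AT n U i t ω) : ℝ) - p.D (M.AT n U i t ω)
        - M.lam i * √n ^ 2 * (M.DT n U i t ω - M.AT n U i t ω)) / √n := by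
    unfold XHat thetaHat
    rw [hXp _ hAT0]
    field_simp
  rw [hid, abs_div, abs_of_pos hr, div_le_iff₀ hr]
  exact h5

/-! ### Good sample paths have probability close to one -/

lemma tendsto_muN_div (M : Model I P) (i : Fin I) :
    Tendsto (fun n : ℕ => M.muN n i / n) atTop (𝓝 (M.mu i)) := by
  have h1 : Tendsto (fun n : ℕ => (M.muN n i - (n * M.mu i + √n * M.muHat i)) / √(n : ℝ))
      atTop (𝓝 0) := (M.muN_expansion i).tendsto_div_nhds_zero
  have hsq : Tendsto (fun n : ℕ => √(n : ℝ)) atTop atTop :=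
    Real.tendsto_sqrt_atTop.comp tendsto_natCast_atTop_atTop
  have h2 : Tendsto (fun n : ℕ => ((M.muN n i - (n * M.mu i + √n * M.muHat i)) / √(n : ℝ)
      + M.muHat i) / √n + M.mu i) atTop (𝓝 (0 + M.mu i)) :=
    ((h1.add_const _).div_atTop hsq).add_const _
  rw [zero_add] at h2
  refine h2.congr' ?_
  filter_upwards [eventually_ge_atTop 1] with n hn
  have hn' : (0 : ℝ) < n := by exact_mod_cast hn
  have hr : 0 < √(n : ℝ) := Real.sqrt_pos.2 hn'
  have hrr : (n : ℝ) = √(n : ℝ) * √n := (Real.mul_self_sqrt hn'.le).symm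
  generalize √(n : ℝ) = r at *
  rw [hrr]
  field_simp
  ring

lemma abs_apply_sub_le_of_edist_le {x y : Fin I → ℝ} {e : ℝ} (he : 0 ≤ e)
    (h : edist x y ≤ ENNReal.ofReal e) (i : Fin I) : |x i - y i| ≤ e := by
  have h1 := (edist_le_pi_edist x y i).trans h
  rwa [edist_dist, ENNReal.ofReal_le_ofReal_iff he, Real.dist_eq] at h1

/-- Four exceptional events, each of probability at most a quarter of `η`, are discarded: irregular
service times `W`, too small service sums `Q`, oscillation of `YHat` (`V`), and a large queue `R`.
The constants `K`, `c` and `δ` are fixed before `n`, so that eventually `c / √n ≤ δ`. -/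
theorem exists_eventually_measure_not_littleUpTo_le [IsProbabilityMeasure P]
    {U : ℕ → Control I Ω} (hU : ∀ n, M.Admissible n (U n)) {T T' : ℝ} (hT : 0 < T) (hT' : T < T')
    (hY : CTight P T' (fun n => M.YHat n (U n))) (hX : TightVars P (fun n => M.supXHat n (U n) T))
    {e : ℝ} (he : 0 < e) {η : ℝ≥0∞} (hη : 0 < η) :
    ∃ c : ℝ, 0 ≤ c ∧ ∀ᶠ n in atTop, P {ω | ¬ M.LittleUpTo n (U n) T c (5 * e) ω} ≤ η := by
  have hη4 : 0 < η / 2 / 2 := ENNReal.half_pos (ENNReal.half_pos hη.ne').ne'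
  obtain ⟨K, hK⟩ := hX _ hη4
  obtain ⟨δ, hδ, N, hN⟩ := hY.modulus (ε := ENNReal.ofReal e) (by simpa using he) hη4
  -- The sum dominates each of its terms, which gives one window constant for all classes.
  set c : ℝ := ∑ i, (K + 6 * e) / M.lam i with hc
  have hterm : ∀ i, 0 ≤ (K + 6 * e) / M.lam i := fun i => by
    have := M.lam_pos i
    positivity
  have hc0 : 0 ≤ c := Finset.sum_nonneg fun i _ => hterm i
  have hcK : ∀ i, K + 6 * e ≤ M.lam i * c := by
    intro i
    have h1 : (K + 6 * e) / M.lam i ≤ c :=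
      Finset.single_le_sum (f := fun i => (K + 6 * e) / M.lam i) (fun j _ => hterm j)
        (Finset.mem_univ i)
    rw [div_le_iff₀ (M.lam_pos i)] at h1
    linarith
  have hT_pos' : 0 < T' := hT.trans hT'
  -- Eventually `muN ≤ (mu + 1) * n`, so `c₀ i * n` bounds the scaled work done up to `T'`.
  set c₀ : Fin I → ℝ := fun i => (M.mu i + 1) * T' with hc₀
  have hc₀0 : ∀ i, 0 < c₀ i := fun i => mul_pos (by linarith [M.mu_pos i]) hT_pos'
  have hwin : Tendsto (fun n : ℕ => ∑ i, P {ω | ∃ j k : ℕ, j ≤ k ∧ (j : ℝ) ≤ (c₀ i + 1) * n ∧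
      (k : ℝ) - j ≤ (K + 2) * √n ∧ e * √n < |∑ l ∈ Finset.range k, M.ST i l ω
        - ∑ l ∈ Finset.range j, M.ST i l ω - ((k : ℝ) - j)|}) atTop (𝓝 0) := by
    have := tendsto_finsetSum (Finset.univ : Finset (Fin I)) fun i _ =>
      tendsto_measure_increment_gt (P := P) (M.ST_measurable i)
        (fun k ω => (M.ST_pos i k ω).le) (M.ST_indep i) (M.ST_identDistrib i) (M.ST_memLp i)
        (M.ST_mean i) (C := c₀ i + 1) (K := K + 2) (ε := e) (by linarith [hc₀0 i])
        (by positivity) he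
    simpa using this
  have hsum : Tendsto (fun n : ℕ => ∑ i, P {ω | ¬ c₀ i * n <
      ∑ l ∈ Finset.range ⌊(c₀ i + 1) * n⌋₊, M.ST i l ω}) atTop (𝓝 0) := by
    have := tendsto_finsetSum (Finset.univ : Finset (Fin I)) fun i _ =>
      tendsto_measure_sum_le (P := P) (M.ST_measurable i) (M.ST_indep i) (M.ST_identDistrib i)
        (M.ST_memLp i) (M.ST_mean i) (hc₀0 i) (lt_add_one (c₀ i))
    simpa using this
  have hsq : Tendsto (fun n : ℕ => √(n : ℝ)) atTop atTop :=
    Real.tendsto_sqrt_atTop.comp tendsto_natCast_atTop_atTop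
  have hcr : Tendsto (fun n : ℕ => c / √(n : ℝ)) atTop (𝓝 0) := tendsto_const_nhds.div_atTop hsq
  have hmu1 : ∀ᶠ n : ℕ in atTop, ∀ i,
      |M.muN n i / n * (M.lam i / M.mu i) - M.lam i| ≤ e / (c + 1) := by
    rw [eventually_all]
    intro i
    have h1 := (((M.tendsto_muN_div i).mul_const (M.lam i / M.mu i)).sub_const (M.lam i)).abs
    rw [mul_div_cancel₀ _ (M.mu_pos i).ne', sub_self, abs_zero] at h1
    exact h1.eventually (ge_mem_nhds (by positivity))
  have hmu2 : ∀ᶠ n : ℕ in atTop, ∀ i, M.muN n i / n ≤ M.mu i + 1 := by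
    rw [eventually_all]
    intro i
    exact (M.tendsto_muN_div i).eventually (ge_mem_nhds (by linarith))
  refine ⟨c, hc0, ?_⟩
  filter_upwards [ENNReal.tendsto_nhds_zero.1 hwin _ hη4, ENNReal.tendsto_nhds_zero.1 hsum _ hη4,
    hmu1, hmu2, eventually_ge_atTop N, eventually_ge_atTop 1, hsq.eventually_ge_atTop (1 / e),
    hcr.eventually (ge_mem_nhds hδ),
    hcr.eventually (ge_mem_nhds (show 0 < (T' - T) / 2 by linarith))]
    with n h1 h2 h3 h4 h5 h6 h7 h8 h9
  have hn' : (0 : ℝ) < n := by exact_mod_cast h6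
  rw [div_le_iff₀ he] at h7
  set W : Fin I → Set Ω := fun i => {ω | ∃ j k : ℕ, j ≤ k ∧ (j : ℝ) ≤ (c₀ i + 1) * n ∧
      (k : ℝ) - j ≤ (K + 2) * √n ∧ e * √n < |∑ l ∈ Finset.range k, M.ST i l ω
        - ∑ l ∈ Finset.range j, M.ST i l ω - ((k : ℝ) - j)|} with hW
  set Q : Fin I → Set Ω := fun i => {ω | ¬ c₀ i * n <
      ∑ l ∈ Finset.range ⌊(c₀ i + 1) * n⌋₊, M.ST i l ω} with hQ
  set V : Set Ω := {ω | ∃ s ∈ Set.Icc 0 T', ∃ t ∈ Set.Icc 0 T', |s - t| ≤ δ ∧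
        ENNReal.ofReal e < edist (M.YHat n (U n) s ω) (M.YHat n (U n) t ω)} with hV
  set R : Set Ω := {ω | (K : ℝ≥0∞) < M.supXHat n (U n) T ω} with hR
  have hsub : P {ω | ¬ M.LittleUpTo n (U n) T c (5 * e) ω} ≤
      P (((⋃ i, W i) ∪ (⋃ i, Q i)) ∪ (V ∪ R)) := by
    refine measure_mono_ae ?_
    filter_upwards [(hU n).ae_exists_queuePath] with ω hp hω
    by_contra hcon
    refine hω ?_
    have hcon' : ω ∉ ((⋃ i, W i) ∪ (⋃ i, Q i)) ∪ (V ∪ R) := hcon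
    simp only [Set.mem_union, Set.mem_iUnion, not_or, not_exists] at hcon'
    obtain ⟨⟨hw, hq⟩, hv, hr⟩ := hcon'
    refine littleUpTo_of_queuePath (hU n) (K := K) (T' := T') (C := fun i => c₀ i + 1) h6 hc0
      K.2 he (by linarith) hcK (by linarith) hp h3 ?_ ?_ ?_ (fun i => by linarith [hc₀0 i]) ?_
    · intro i s hs t ht hst
      refine abs_apply_sub_le_of_edist_le he.le ?_ i
      by_contra h
      exact hv ⟨s, hs, t, ht, hst.trans h8, not_le.1 h⟩
    · intro i j k hjk hj hk
      by_contra h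
      exact hw i ⟨j, k, hjk, hj, hk, not_le.1 h⟩
    · intro i
      have h10 := h4 i
      rw [div_le_iff₀ hn'] at h10
      refine lt_of_le_of_lt ?_ (not_not.1 (hq i))
      calc M.muN n i * T' ≤ (M.mu i + 1) * n * T' := by gcongr
        _ = c₀ i * n := by rw [hc₀]; ring
    · intro i t ht
      have h10 : ENNReal.ofReal |M.XHat n (U n) t ω i| ≤ (K : ℝ≥0∞) :=
        calc ENNReal.ofReal |M.XHat n (U n) t ω i|
            ≤ ∑ i, ENNReal.ofReal |M.XHat n (U n) t ω i| :=
              Finset.single_le_sum (f := fun i => ENNReal.ofReal |M.XHat n (U n) t ω i|)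
                (fun _ _ => zero_le) (Finset.mem_univ i)
          _ ≤ M.supXHat n (U n) T ω :=
              le_iSup₂ (f := fun t _ => ∑ i, ENNReal.ofReal |M.XHat n (U n) t ω i|) t ht
          _ ≤ K := not_lt.1 hr
      rw [← ENNReal.ofReal_coe_nnreal, ENNReal.ofReal_le_ofReal_iff K.coe_nonneg] at h10
      exact (le_abs_self _).trans h10
  calc P {ω | ¬ M.LittleUpTo n (U n) T c (5 * e) ω}
      ≤ P (((⋃ i, W i) ∪ (⋃ i, Q i)) ∪ (V ∪ R)) := hsub
    _ ≤ (P (⋃ i, W i) + P (⋃ i, Q i)) + (P V + P R) :=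
      (measure_union_le _ _).trans (add_le_add (measure_union_le _ _) (measure_union_le _ _))
    _ ≤ (η / 2 / 2 + η / 2 / 2) + (η / 2 / 2 + η / 2 / 2) := by
      refine add_le_add (add_le_add ?_ ?_) (add_le_add (hN n h5) (hK n))
      · exact (measure_iUnion_fintype_le _ _).trans h1
      · exact (measure_iUnion_fintype_le _ _).trans h2
    _ = η := by
      rw [ENNReal.add_halves, ENNReal.add_halves]

/-! ### Convergence of the errors -/

/-- The factor six allows `5 * e` for the pathwise law and one `e` for moving the queue from the
admission time back to `t`. -/
lemma exists_pos_card_mul_ofReal_le (I : ℕ) {ε : ℝ≥0∞} (hε : 0 < ε) :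
    ∃ e : ℝ, 0 < e ∧ (I : ℝ≥0∞) * ENNReal.ofReal (6 * e) ≤ ε := by
  obtain ⟨x, hx0, hx⟩ := ENNReal.lt_iff_exists_real_btwn.1 hε
  have hx' : 0 < x := by simpa using hx.1
  refine ⟨x / (6 * (I + 1)), by positivity, le_trans ?_ hx.2.le⟩
  rw [← ENNReal.ofReal_natCast, ← ENNReal.ofReal_mul (by positivity)]
  refine ENNReal.ofReal_le_ofReal ?_
  have : (I : ℝ) * (6 * (x / (6 * (I + 1)))) = x * (I / (I + 1)) := by field_simp
  rw [this]
  refine mul_le_of_le_one_right hx'.le ?_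
  rw [div_le_one (by positivity)]
  linarith

lemma supE_le_of_littleUpTo {T c e : ℝ} {ω : Ω} (h : M.LittleUpTo n U T c e ω) :
    M.supE n U T ω ≤ I * ENNReal.ofReal e := by
  refine iSup₂_le fun t ht => ?_
  have : ∀ i, M.absE n U i t ω ≤ ENNReal.ofReal e := fun i => by
    obtain ⟨h1, -, -, h2⟩ := h i t ht
    rw [absE, if_pos h1]
    exact ENNReal.ofReal_le_ofReal h2
  exact (Finset.sum_le_sum fun i _ => this i).trans (by simp)

lemma supETilde_le_of_littleUpTo {T c e e' : ℝ} {ω : Ω} (h : M.LittleUpTo n U T c e ω)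
    (hX : ∀ i, ∀ t ∈ Set.Icc (0 : ℝ) T, ∀ s, t ≤ s → s ≤ t + c / √n →
      |M.XHat n U t ω i - M.XHat n U s ω i| ≤ e') :
    M.supETilde n U T ω ≤ I * ENNReal.ofReal (e + e') := by
  refine iSup₂_le fun t ht => ?_
  have : ∀ i, M.absETilde n U i t ω ≤ ENNReal.ofReal (e + e') := fun i => by
    obtain ⟨h1, h2, h3, h4⟩ := h i t ht
    rw [absETilde, if_pos h1]
    refine ENNReal.ofReal_le_ofReal ?_
    have h5 := hX i t ht _ h2 h3
    have h6 := abs_sub_le (M.XHat n U t ω i) (M.XHat n U (M.AT n U i t ω) ω i)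
      (M.lam i * M.thetaHat n U i t ω)
    linarith
  exact (Finset.sum_le_sum fun i _ => this i).trans (by simp)

end Model

end HeavyTraffic

end

theorem proposition3 {I : ℕ} {Ω : Type*} [MeasurableSpace Ω] (P : Measure Ω)
    [IsProbabilityMeasure P] (M : HeavyTraffic.Model I P)
    (U : ℕ → HeavyTraffic.Control I Ω) (hU : ∀ n, M.Admissible n (U n))
    (T T' : ℝ) (hT : 0 < T) (hT' : T < T')
    (hY : HeavyTraffic.CTight P T' (fun n => M.YHat n (U n)))
    (hX : HeavyTraffic.TightVars P (fun n => M.supXHat n (U n) T)) :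
    HeavyTraffic.ConvergesToZero P (fun n => M.supE n (U n) T) ∧
    (HeavyTraffic.CTight P T' (fun n => M.XHat n (U n)) →
      HeavyTraffic.ConvergesToZero P (fun n => M.supETilde n (U n) T)) := by
  refine ⟨fun ε hε => ?_, fun hXC ε hε => ?_⟩
  · obtain ⟨e, he, heε⟩ := HeavyTraffic.Model.exists_pos_card_mul_ofReal_le I hε
    rw [ENNReal.tendsto_nhds_zero]
    intro η hη
    obtain ⟨c, -, h⟩ := HeavyTraffic.Model.exists_eventually_measure_not_littleUpTo_le hU hT hT'
      hY hX he hη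
    filter_upwards [h] with n hn
    refine (measure_mono fun ω hω hgood => ?_).trans hn
    refine absurd (M.supE_le_of_littleUpTo hgood) (not_le.2 (lt_of_le_of_lt ?_ hω))
    refine le_trans ?_ heε
    gcongr
    linarith
  · obtain ⟨e, he, heε⟩ := HeavyTraffic.Model.exists_pos_card_mul_ofReal_le I hε
    rw [ENNReal.tendsto_nhds_zero]
    intro η hη
    have hη2 : 0 < η / 2 := ENNReal.half_pos hη.ne'
    obtain ⟨c, hc, h⟩ := HeavyTraffic.Model.exists_eventually_measure_not_littleUpTo_le hU hT hT'
      hY hX he hη2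
    obtain ⟨δ, hδ, N, hN⟩ := hXC.modulus (ε := ENNReal.ofReal e) (by simpa using he) hη2
    have hcr : Tendsto (fun n : ℕ => c / √(n : ℝ)) atTop (𝓝 0) :=
      tendsto_const_nhds.div_atTop (Real.tendsto_sqrt_atTop.comp tendsto_natCast_atTop_atTop)
    filter_upwards [h, eventually_ge_atTop N, hcr.eventually (ge_mem_nhds hδ),
      hcr.eventually (ge_mem_nhds (sub_pos.2 hT'))] with n hn hnN hnδ hnT
    refine le_trans ?_ ((add_le_add hn (hN n hnN)).trans (ENNReal.add_halves η).le)
    refine le_trans (measure_mono fun ω hω => ?_) (measure_union_le _ _)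
    by_contra hcon
    simp only [Set.mem_union, Set.mem_ofPred_eq, not_or, not_not] at hcon
    obtain ⟨hgood, hmod⟩ := hcon
    -- From `c / √n ≤ T' - T`, the admission time stays in `[0, T']`, where the modulus of `XHat` is
    -- controlled.
    have hle := M.supETilde_le_of_littleUpTo (e' := e) hgood fun i t ht s hts hs => by
      refine HeavyTraffic.Model.abs_apply_sub_le_of_edist_le he.le ?_ i
      by_contra hlt
      refine hmod ⟨t, ⟨ht.1, by linarith [ht.2]⟩, s, ⟨ht.1.trans hts, by linarith [ht.2]⟩, ?_,
        not_le.1 hlt⟩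
      rw [abs_sub_comm, abs_of_nonneg (sub_nonneg.2 hts)]
      linarith
    refine absurd hle (not_le.2 (lt_of_le_of_lt ?_ hω))
    rw [show 5 * e + e = 6 * e by ring]
    exact heε
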